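/- Let $n\ge 1$, $\alpha,\beta>0$, $d\gamma(y)=e^{-|y|^2}\,dy$ on $\mathbb{R}^n$, and $\mathbb{R}^{n+1}_+=\mathbb{R}^n\times(0,\infty)$. Put $m(x)=1$ if $|x|\le 1$, $m(x)=1/|x|$ if $|x|\ge 1$, $m_\beta=\beta m$, and let $B(c,r)$ be the open ball of centre $c$ and radius $r$, and $a\wedge b=\min(a,b)$. For $x\in\mathbb{R}^n$ and $O\subset\mathbb{R}^n$ let $$\Gamma(x)=\{(y,t)\in\mathbb{R}^{n+1}_+: |y-x|<\alpha t\wedge m_\beta(y)\},\qquad T(O)=\mathbb{R}^{n+1}_+\setminus\bigcup_{x\notin O}\Gamma(x).$$ For measurable $f:\mathbb{R}^{n+1}_+\to\mathbb{R}$ and $1\le q<\infty$ let $$S_{q}f(x)=\Big(\iint_{\Gamma(x)}\frac{|f(y,t)|^q}{\gamma(B(y,\alpha t\wedge m_\beta(y)))}\,d\gamma(y)\frac{dt}{t}\Big)^{1/q},\qquad C_{q}f(x)=\sup_{B}\Big(\frac1{\gamma(B)}\iint_{T(B)}|f(y,t)|^q\,d\gamma(y)\frac{dt}{t}\Big)^{1/q},$$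 the supremum being over all open balls $B=B(c_B,r_B)$, $r_B>0$, with $x\in B(c_B,\alpha r_B\wedge m_\beta(c_B))$. For $1\le p<\infty$ and $1\le q<\infty$ let $T^{p,q}_{\alpha,\beta}(\gamma)$ be the space of measurable $f:\mathbb{R}^{n+1}_+\to\mathbb{R}$ (modulo equality almost everywhere) with $\|f\|_{T^{p,q}_{\alpha,\beta}(\gamma)}:=\|S_{q}f\|_{L^p(\gamma)}<\infty$, and for $1<q<\infty$ let $T^{\infty,q}_{\alpha,\beta}(\gamma)$ be the space of those with $\|f\|_{T^{\infty,q}_{\alpha,\beta}(\gamma)}:=\|C_{q}f\|_{L^\infty(\gamma)}<\infty$. **Theorem.** Let $1\le p<\infty$ and $1<q<\infty$, with conjugate exponents $p'\in(1,\infty]$ and $q'\in(1,\infty)$. For all $g\in T^{p',q'}_{\alpha,\beta}(\gamma)$ and $f\in T^{p,q}_{\alpha,\beta}(\gamma)$ the function $gf$ is integrable with respect to $d\gamma(y)\,dt/t$ on $\mathbb{R}^{n+1}_+$, and $$g\longmapsto\Big(f\mapsto\iint_{\mathbb{R}^{n+1}_+}g(y,t)\,f(y,t)\,d\gamma(y)\frac{dt}{t}\Big)$$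 is a linear homeomorphism (that is, a linear bijection with equivalence of norms) of $T^{p',q'}_{\alpha,\beta}(\gamma)$ onto the dual space of $T^{p,q}_{\alpha,\beta}(\gamma)$. -/

import Mathlib

open MeasureTheory Set
open scoped ENNReal

noncomputable section

namespace GaussTent

/-- The space `ℝⁿ` with its Euclidean norm. -/
abbrev E (n : ℕ) : Type := EuclideanSpace ℝ (Fin n)

/-- The (unnormalized) Gaussian measure `dγ(y) = exp(-|y|²) dy` on `ℝⁿ`. -/
def gauss (n : ℕ) : Measure (E n) :=
  (volume : Measure (E n)).withDensity fun y => ENNReal.ofReal (Real.exp (-‖y‖ ^ 2))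

/-- The measure `dt/t` on `(0, ∞)`, as a measure on `ℝ` that gives no mass to `(-∞, 0]`. -/
def dtOverT : Measure ℝ :=
  ((volume : Measure ℝ).restrict (Ioi 0)).withDensity fun t => ENNReal.ofReal t⁻¹

/-- The measure `dγ(y) dt/t` on the half-space `ℝⁿ × (0, ∞)`, as a measure on `ℝⁿ × ℝ` that gives
no mass to the complement of the half-space. Functions on the half-space, up to equality almost
everywhere, are therefore the same as functions on `ℝⁿ × ℝ` up to equality almost everywhere. -/
def halfMeasure (n : ℕ) : Measure (E n × ℝ) := (gauss n).prod dtOverT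

/-- The cutoff function `m(x) = 1` for `|x| ≤ 1` and `m(x) = 1/|x|` for `|x| ≥ 1`. -/
def cutoff {n : ℕ} (x : E n) : ℝ := if ‖x‖ ≤ 1 then 1 else 1 / ‖x‖

/-- The radius `αt ∧ m_β(y)`, where `m_β = β m`. -/
def rad {n : ℕ} (α β : ℝ) (y : E n) (t : ℝ) : ℝ := min (α * t) (β * cutoff y)

/-- The Gaussian cone `{(y,t) : t > 0, |y - x| < αt ∧ m_β(y)}` with vertex `x`. -/
def cone {n : ℕ} (α β : ℝ) (x : E n) : Set (E n × ℝ) :=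
  {z | 0 < z.2 ∧ dist z.1 x < rad α β z.1 z.2}

/-- The Gaussian tent over `O`: the complement, in the half-space, of the union of the cones with
vertices outside `O`. -/
def tent {n : ℕ} (α β : ℝ) (O : Set (E n)) : Set (E n × ℝ) :=
  {z | 0 < z.2} \ ⋃ x ∈ Oᶜ, cone α β x

/-- The area function `S_{q,α,β} f`, with values in `[0, ∞]`. -/
def areaFun {n : ℕ} (q α β : ℝ) (f : E n × ℝ → ℝ) (x : E n) : ℝ≥0∞ :=
  (∫⁻ z in cone α β x, ‖f z‖ₑ ^ q / gauss n (Metric.ball z.1 (rad α β z.1 z.2))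
    ∂(halfMeasure n)) ^ (1 / q)

/-- The Carleson functional `C_{q,α,β} f`, with values in `[0, ∞]`: the supremum is over all open
balls `B = B(c, r)` with `x ∈ B(c, αr ∧ m_β(c))`. -/
def carlesonFun {n : ℕ} (q α β : ℝ) (f : E n × ℝ → ℝ) (x : E n) : ℝ≥0∞ :=
  ⨆ (c : E n) (r : ℝ) (_ : 0 < r) (_ : x ∈ Metric.ball c (rad α β c r)),
    ((gauss n (Metric.ball c r))⁻¹ *
      ∫⁻ z in tent α β (Metric.ball c r), ‖f z‖ₑ ^ q ∂(halfMeasure n)) ^ (1 / q)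

/-- The tent space norm, with values in `[0, ∞]`: the `L^p(γ)` norm of `S_{q,α,β} f` when `p < ∞`,
and the `L^∞(γ)` norm of `C_{q,α,β} f` when `p = ∞`. -/
def tentENorm {n : ℕ} (p : ℝ≥0∞) (q α β : ℝ) (f : E n × ℝ → ℝ) : ℝ≥0∞ :=
  if p = ∞ then eLpNorm (carlesonFun q α β f) ∞ (gauss n)
  else eLpNorm (areaFun q α β f) p (gauss n)

/-! ### Facts needed to see that the tent spaces are normed spaces -/

section aux

variable {n : ℕ}

instance : SFinite (gauss n) := by unfold gauss; infer_instance

instance : SFinite dtOverT := by unfold dtOverT; infer_instance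

instance : SFinite (halfMeasure n) := by unfold halfMeasure; infer_instance

lemma measurable_cutoff : Measurable (cutoff (n := n)) := by
  unfold cutoff
  refine Measurable.ite ?_ measurable_const (measurable_norm.const_div 1)
  exact measurableSet_le measurable_norm measurable_const

lemma cutoff_pos (x : E n) : 0 < cutoff x := by
  unfold cutoff
  split_ifs with h
  · exact one_pos
  · have : 0 < ‖x‖ := by linarith
    positivity

lemma cutoff_le_one (x : E n) : cutoff x ≤ 1 := by
  unfold cutoff
  split_ifs with h
  · exact le_rfl
  · exact (div_le_one (by linarith)).2 (by linarith)

lemma measurable_rad (α β : ℝ) : Measurable fun z : E n × ℝ => rad α β z.1 z.2 := by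
  unfold rad
  exact (measurable_snd.const_mul α).min ((measurable_cutoff.comp measurable_fst).const_mul β)

lemma rad_pos {α β : ℝ} (hα : 0 < α) (hβ : 0 < β) (y : E n) {t : ℝ} (ht : 0 < t) :
    0 < rad α β y t :=
  lt_min (mul_pos hα ht) (mul_pos hβ (cutoff_pos y))

lemma measurableSet_dist (α β : ℝ) :
    MeasurableSet {w : (E n × ℝ) × E n | dist w.1.1 w.2 < rad α β w.1.1 w.1.2} :=
  measurableSet_lt ((measurable_fst.comp measurable_fst).dist measurable_snd)
    ((measurable_rad α β).comp measurable_fst)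

lemma measurableSet_cone (α β : ℝ) (x : E n) : MeasurableSet (cone α β x) := by
  refine (measurableSet_lt measurable_const measurable_snd).inter ?_
  exact measurableSet_lt (measurable_fst.dist measurable_const) (measurable_rad α β)

lemma measurable_weight (α β : ℝ) :
    Measurable fun z : E n × ℝ => gauss n (Metric.ball z.1 (rad α β z.1 z.2)) := by
  have h := measurable_measure_prodMk_left (ν := gauss n) (measurableSet_dist (n := n) α β)
  convert h using 3 with z
  ext x
  simp [Metric.mem_ball, dist_comm]

lemma gauss_ball_lt_top (c : E n) (r : ℝ) : gauss n (Metric.ball c r) < ∞ := by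
  unfold gauss
  rw [withDensity_apply _ measurableSet_ball]
  calc _ ≤ ∫⁻ _ in Metric.ball c r, 1 ∂(volume : Measure (E n)) := by
        refine lintegral_mono fun y => ?_
        rw [ENNReal.ofReal_le_one]
        exact Real.exp_le_one_iff.2 (by nlinarith [sq_nonneg ‖y‖])
    _ < ∞ := by simpa using measure_ball_lt_top

lemma gauss_ball_pos (c : E n) {r : ℝ} (hr : 0 < r) : 0 < gauss n (Metric.ball c r) := by
  have hac : (volume : Measure (E n)) ≪ gauss n := by
    refine withDensity_absolutelyContinuous' ?_ ?_
    · fun_prop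
    · exact Filter.Eventually.of_forall fun y => by simp [Real.exp_pos]
  refine pos_iff_ne_zero.2 fun h => ?_
  exact (Metric.measure_ball_pos volume c hr).ne' (hac h)

lemma ae_pos : ∀ᵐ z ∂(halfMeasure n), 0 < z.2 := by
  have h1 : ∀ᵐ t ∂dtOverT, 0 < t := by
    unfold dtOverT
    exact (withDensity_absolutelyContinuous _ _).ae_le (ae_restrict_mem measurableSet_Ioi)
  exact Measure.quasiMeasurePreserving_snd.ae h1

/-- Minkowski's inequality, with a weight. -/
lemma weighted_minkowski {X : Type*} [MeasurableSpace X] (ν : Measure X) {q : ℝ} (hq : 1 ≤ q)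
    {f g : X → ℝ} (hf : Measurable f) (hg : Measurable g) {w : X → ℝ≥0∞} (hw : Measurable w) :
    (∫⁻ z, ‖f z + g z‖ₑ ^ q / w z ∂ν) ^ (1 / q) ≤
      (∫⁻ z, ‖f z‖ₑ ^ q / w z ∂ν) ^ (1 / q) + (∫⁻ z, ‖g z‖ₑ ^ q / w z ∂ν) ^ (1 / q) := by
  have hq0 : 0 < q := by linarith
  have key : ∀ (a b : ℝ≥0∞), a ^ q / b = (a * (b⁻¹) ^ (1 / q)) ^ q := fun a b => by
    rw [ENNReal.mul_rpow_of_nonneg _ _ hq0.le, ← ENNReal.rpow_mul, one_div_mul_cancel hq0.ne',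
      ENNReal.rpow_one, div_eq_mul_inv]
  simp only [key]
  refine le_trans ?_ (ENNReal.lintegral_Lp_add_le (f := fun z => ‖f z‖ₑ * (w z)⁻¹ ^ (1 / q))
    (g := fun z => ‖g z‖ₑ * (w z)⁻¹ ^ (1 / q)) ?_ ?_ hq)
  · gcongr with z
    simp only [Pi.add_apply, ← add_mul]
    gcongr
    exact enorm_add_le _ _
  · exact (hf.enorm.mul (hw.inv.pow_const _)).aemeasurable
  · exact (hg.enorm.mul (hw.inv.pow_const _)).aemeasurable

lemma measurable_integrand (q α β : ℝ) {f : E n × ℝ → ℝ} (hf : Measurable f) :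
    Measurable fun z => ‖f z‖ₑ ^ q / gauss n (Metric.ball z.1 (rad α β z.1 z.2)) :=
  (hf.enorm.pow_const q).div (measurable_weight α β)

lemma measurableSet_cone' (α β : ℝ) :
    MeasurableSet {w : E n × (E n × ℝ) | w.2 ∈ cone α β w.1} := by
  refine (measurableSet_lt measurable_const (measurable_snd.comp measurable_snd)).inter ?_
  exact measurableSet_lt ((measurable_fst.comp measurable_snd).dist measurable_fst)
    ((measurable_rad α β).comp measurable_snd)

lemma measurable_kernel (α β : ℝ) {h : E n × ℝ → ℝ≥0∞} (hh : Measurable h) :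
    Measurable fun w : E n × (E n × ℝ) => (cone α β w.1).indicator h w.2 := by
  have := (hh.comp (measurable_snd (α := E n))).indicator (measurableSet_cone' (n := n) α β)
  convert this using 1
  funext w
  by_cases hw : w.2 ∈ cone α β w.1 <;> simp [indicator, hw]

lemma measurable_areaFun (q α β : ℝ) {f : E n × ℝ → ℝ} (hf : Measurable f) :
    Measurable (areaFun q α β f) := by
  unfold areaFun
  refine Measurable.pow_const ?_ _
  simp_rw [← lintegral_indicator (measurableSet_cone α β _)]
  exact (measurable_kernel α β (measurable_integrand q α β hf)).lintegral_prod_right'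

lemma areaFun_add_le {q : ℝ} (hq : 1 ≤ q) (α β : ℝ) {f g : E n × ℝ → ℝ} (hf : Measurable f)
    (hg : Measurable g) (x : E n) :
    areaFun q α β (fun z => f z + g z) x ≤ areaFun q α β f x + areaFun q α β g x :=
  weighted_minkowski _ hq hf hg (measurable_weight α β)

lemma carlesonFun_add_le {q : ℝ} (hq : 1 ≤ q) (α β : ℝ) {f g : E n × ℝ → ℝ} (hf : Measurable f)
    (hg : Measurable g) (x : E n) :
    carlesonFun q α β (fun z => f z + g z) x ≤ carlesonFun q α β f x + carlesonFun q α β g x := by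
  have hq0 : 0 ≤ 1 / q := by positivity
  refine iSup_le fun c => iSup_le fun r => iSup_le fun hr => iSup_le fun hx => ?_
  have h := weighted_minkowski ((halfMeasure n).restrict (tent α β (Metric.ball c r))) hq hf hg
    (measurable_const (a := (1 : ℝ≥0∞)))
  simp only [div_one] at h
  have h2 : ∀ u : E n × ℝ → ℝ, ((gauss n (Metric.ball c r))⁻¹ *
      ∫⁻ z in tent α β (Metric.ball c r), ‖u z‖ₑ ^ q ∂(halfMeasure n)) ^ (1 / q) ≤
        carlesonFun q α β u x := fun u => by
    unfold carlesonFun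
    exact le_iSup_of_le c (le_iSup_of_le r (le_iSup_of_le hr (le_iSup_of_le hx le_rfl)))
  refine le_trans ?_ (add_le_add (h2 f) (h2 g))
  rw [ENNReal.mul_rpow_of_nonneg _ _ hq0, ENNReal.mul_rpow_of_nonneg _ _ hq0,
    ENNReal.mul_rpow_of_nonneg _ _ hq0, ← mul_add]
  gcongr

lemma tentENorm_add_le {p : ℝ≥0∞} (hp : 1 ≤ p) {q : ℝ} (hq : 1 ≤ q) (α β : ℝ)
    {f g : E n × ℝ → ℝ} (hf : Measurable f) (hg : Measurable g) :
    tentENorm p q α β (fun z => f z + g z) ≤ tentENorm p q α β f + tentENorm p q α β g := by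
  unfold tentENorm
  split_ifs with h
  · simp only [eLpNorm_exponent_top]
    refine le_trans ?_ eLpNormEssSup_add_le
    refine eLpNormEssSup_mono_enorm_ae (Filter.Eventually.of_forall fun x => ?_)
    simpa using carlesonFun_add_le hq α β hf hg x
  · refine le_trans ?_ (eLpNorm_add_le
      (measurable_areaFun q α β hf).aestronglyMeasurable
      (measurable_areaFun q α β hg).aestronglyMeasurable hp)
    refine eLpNorm_mono_enorm fun x => ?_
    simpa using areaFun_add_le hq α β hf hg x

lemma tentENorm_congr (p : ℝ≥0∞) (q α β : ℝ) {f g : E n × ℝ → ℝ}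
    (h : f =ᵐ[halfMeasure n] g) : tentENorm p q α β f = tentENorm p q α β g := by
  have h1 : areaFun q α β f = areaFun q α β g := by
    funext x
    unfold areaFun
    congr 1
    refine lintegral_congr_ae (ae_restrict_of_ae ?_)
    filter_upwards [h] with z hz
    rw [hz]
  have h2 : carlesonFun q α β f = carlesonFun q α β g := by
    funext x
    unfold carlesonFun
    refine iSup_congr fun c => iSup_congr fun r => iSup_congr fun _ => iSup_congr fun _ => ?_
    congr 2
    refine lintegral_congr_ae (ae_restrict_of_ae ?_)
    filter_upwards [h] with z hz
    rw [hz]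
  unfold tentENorm
  rw [h1, h2]

lemma tentENorm_smul (p : ℝ≥0∞) {q : ℝ} (hq : 1 ≤ q) (α β : ℝ) (c : ℝ) {f : E n × ℝ → ℝ}
    (hf : Measurable f) :
    tentENorm p q α β (fun z => c * f z) = ‖c‖ₑ * tentENorm p q α β f := by
  have hq0 : 0 < q := by linarith
  have hq1 : 0 ≤ 1 / q := by positivity
  have hc : (‖c‖ₑ ^ q) ^ (1 / q) = ‖c‖ₑ := by
    rw [← ENNReal.rpow_mul, mul_one_div_cancel hq0.ne', ENNReal.rpow_one]
  have h1 : areaFun q α β (fun z => c * f z) = fun x => ‖c‖ₑ * areaFun q α β f x := by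
    funext x
    unfold areaFun
    simp_rw [enorm_mul, ENNReal.mul_rpow_of_nonneg _ _ hq0.le, mul_div_assoc]
    rw [lintegral_const_mul _ (measurable_integrand q α β hf),
      ENNReal.mul_rpow_of_nonneg _ _ hq1, hc]
  have h2 : carlesonFun q α β (fun z => c * f z) = fun x => ‖c‖ₑ * carlesonFun q α β f x := by
    funext x
    unfold carlesonFun
    simp_rw [ENNReal.mul_iSup]
    refine iSup_congr fun a => iSup_congr fun r => iSup_congr fun _ => iSup_congr fun _ => ?_
    simp_rw [enorm_mul, ENNReal.mul_rpow_of_nonneg _ _ hq0.le]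
    rw [lintegral_const_mul _ (hf.enorm.pow_const q), mul_left_comm,
      ENNReal.mul_rpow_of_nonneg _ _ hq1, hc]
  unfold tentENorm
  rw [h1, h2]
  split_ifs with hp
  · simp only [eLpNorm_exponent_top, eLpNormEssSup, enorm_eq_self, ENNReal.essSup_const_mul]
  · by_cases hp0 : p = 0
    · simp [hp0]
    have hp1 : 0 < p.toReal := ENNReal.toReal_pos hp0 hp
    have hp2 : (0 : ℝ) ≤ 1 / p.toReal := by positivity
    rw [eLpNorm_eq_lintegral_rpow_enorm_toReal hp0 hp,
      eLpNorm_eq_lintegral_rpow_enorm_toReal hp0 hp]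
    simp only [enorm_eq_self, ENNReal.mul_rpow_of_nonneg _ _ hp1.le]
    rw [lintegral_const_mul _ ((measurable_areaFun q α β hf).pow_const _),
      ENNReal.mul_rpow_of_nonneg _ _ hp2, ← ENNReal.rpow_mul, mul_one_div_cancel hp1.ne',
      ENNReal.rpow_one]

lemma tentENorm_zero (p : ℝ≥0∞) {q : ℝ} (hq : 1 ≤ q) (α β : ℝ) :
    tentENorm p q α β (fun _ : E n × ℝ => (0 : ℝ)) = 0 := by
  have := tentENorm_smul (n := n) p hq α β 0 (f := fun _ => 0) measurable_const
  simpa using this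

lemma ae_eq_zero_of_areaFun {p : ℝ≥0∞} (hp : 1 ≤ p) {q : ℝ} (hq : 1 ≤ q) {α β : ℝ} (hα : 0 < α)
    (hβ : 0 < β) {f : E n × ℝ → ℝ} (hf : Measurable f)
    (h : eLpNorm (areaFun q α β f) p (gauss n) = 0) : f =ᵐ[halfMeasure n] 0 := by
  have hq0 : 0 < q := by linarith
  rw [eLpNorm_eq_zero_iff (measurable_areaFun q α β hf).aestronglyMeasurable
    (by positivity)] at h
  set H : E n × ℝ → ℝ≥0∞ :=
    fun z => ‖f z‖ₑ ^ q / gauss n (Metric.ball z.1 (rad α β z.1 z.2)) with hH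
  have hHm : Measurable H := measurable_integrand q α β hf
  have h0 : ∫⁻ x, ∫⁻ z, (cone α β x).indicator H z ∂(halfMeasure n) ∂(gauss n) = 0 := by
    rw [lintegral_eq_zero_iff (measurable_kernel α β hHm).lintegral_prod_right']
    filter_upwards [h] with x hx
    rw [lintegral_indicator (measurableSet_cone α β x)]
    simpa [areaFun, hq0, hq0.not_gt] using hx
  rw [lintegral_lintegral_swap (measurable_kernel α β hHm).aemeasurable,
    lintegral_eq_zero_iff (measurable_kernel α β hHm).lintegral_prod_left'] at h0
  filter_upwards [h0, ae_pos] with z hz hz2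
  have hi : ∀ x, (cone α β x).indicator H z =
      (Metric.ball z.1 (rad α β z.1 z.2)).indicator (fun _ => H z) x := fun x => by
    simp only [indicator, cone, mem_ofPred_eq, hz2, true_and, Metric.mem_ball, dist_comm z.1 x]
  simp_rw [hi] at hz
  rw [lintegral_indicator measurableSet_ball] at hz
  have hb := (gauss_ball_pos z.1 (rad_pos hα hβ z.1 hz2)).ne'
  have hb2 := (gauss_ball_lt_top z.1 (rad α β z.1 z.2)).ne
  simpa [hH, hb, hb2, hq0, hq0.not_gt] using hz

lemma ae_eq_zero_of_carlesonFun {q : ℝ} (hq : 1 ≤ q) {α β : ℝ} (hα : 0 < α)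
    (hβ : 0 < β) {f : E n × ℝ → ℝ} (hf : Measurable f)
    (h : eLpNorm (carlesonFun q α β f) ∞ (gauss n) = 0) : f =ᵐ[halfMeasure n] 0 := by
  have hq0 : 0 < q := by linarith
  simp only [eLpNorm_exponent_top, eLpNormEssSup_eq_zero_iff] at h
  have h1 : ∀ k : ℕ, ∀ᵐ z ∂(halfMeasure n),
      z ∈ tent α β (Metric.ball (0 : E n) (k + 1 : ℝ)) → f z = 0 := by
    intro k
    have hk : (0 : ℝ) < k + 1 := by positivity
    obtain ⟨x, hx, hx0⟩ : ∃ x ∈ Metric.ball (0 : E n) (rad α β 0 (k + 1)),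
        carlesonFun q α β f x = 0 := by
      by_contra! hcon
      have hpos : 0 < gauss n (Metric.ball (0 : E n) (rad α β (0 : E n) (k + 1))) :=
        gauss_ball_pos (0 : E n) (rad_pos hα hβ (0 : E n) hk)
      exact hpos.ne' (measure_mono_null (fun x hx => hcon x hx) h)
    have h2 : ((gauss n (Metric.ball 0 (k + 1 : ℝ)))⁻¹ *
        ∫⁻ z in tent α β (Metric.ball 0 (k + 1 : ℝ)), ‖f z‖ₑ ^ q ∂(halfMeasure n)) ^ (1 / q)
          = 0 := by
      simp only [carlesonFun, ENNReal.iSup_eq_zero] at hx0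
      exact hx0 0 (k + 1) hk hx
    have h3 : ∫⁻ z in tent α β (Metric.ball 0 (k + 1 : ℝ)), ‖f z‖ₑ ^ q ∂(halfMeasure n) = 0 := by
      simpa [hq0, hq0.not_gt, (gauss_ball_lt_top (0 : E n) (k + 1 : ℝ)).ne] using h2
    rw [lintegral_eq_zero_iff (hf.enorm.pow_const q)] at h3
    filter_upwards [ae_imp_of_ae_restrict h3] with z hz hzt
    simpa [hq0, hq0.not_gt] using hz hzt
  filter_upwards [ae_all_iff.2 h1, ae_pos] with z hz hz2
  obtain ⟨k, hk⟩ := exists_nat_ge (‖z.1‖ + β)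
  refine hz k ⟨hz2, ?_⟩
  simp only [mem_iUnion, not_exists, cone, mem_ofPred_eq, not_and, not_lt, mem_compl_iff,
    Metric.mem_ball, dist_zero_right]
  intro x hx _
  have h4 : rad α β z.1 z.2 ≤ β :=
    (min_le_right _ _).trans (mul_le_of_le_one_right hβ.le (cutoff_le_one _))
  have h5 : ‖x‖ - ‖z.1‖ ≤ dist z.1 x := by
    rw [dist_comm, dist_eq_norm]; exact norm_sub_norm_le _ _
  linarith

end aux

/-- The Gaussian tent space `T^{p,q}_{α,β}(γ)`, for `1 ≤ p ≤ ∞` and `1 ≤ q < ∞`: the measurable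
functions on the half-space, up to equality almost everywhere, whose tent space norm is finite. -/
def tentSpace (n : ℕ) (p : ℝ≥0∞) (q α β : ℝ) [hp : Fact (1 ≤ p)] [hq : Fact (1 ≤ q)] :
    Submodule ℝ (E n × ℝ →ₘ[halfMeasure n] ℝ) where
  carrier := {f | tentENorm p q α β f < ∞}
  add_mem' {f g} hf hg := by
    simp only [mem_ofPred_eq] at hf hg ⊢
    rw [tentENorm_congr p q α β (AEEqFun.coeFn_add f g)]
    exact (tentENorm_add_le hp.out hq.out α β f.measurable g.measurable).trans_lt
      (ENNReal.add_lt_top.2 ⟨hf, hg⟩)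
  zero_mem' := by
    simp only [mem_ofPred_eq]
    rw [tentENorm_congr p q α β AEEqFun.coeFn_zero]
    exact (tentENorm_zero p hq.out α β).trans_lt ENNReal.zero_lt_top
  smul_mem' c f hf := by
    simp only [mem_ofPred_eq] at hf ⊢
    rw [tentENorm_congr p q α β (AEEqFun.coeFn_smul c f)]
    exact (tentENorm_smul p hq.out α β c f.measurable).trans_lt
      (ENNReal.mul_lt_top enorm_lt_top hf)

section norm

variable {n : ℕ} {p : ℝ≥0∞} {q α β : ℝ} [hp : Fact (1 ≤ p)] [hq : Fact (1 ≤ q)]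

instance : Norm (tentSpace n p q α β) where
  norm f := (tentENorm p q α β (f : E n × ℝ →ₘ[halfMeasure n] ℝ)).toReal

lemma tentSpace_core [hα : Fact (0 < α)] [hβ : Fact (0 < β)] :
    NormedSpace.Core ℝ (tentSpace n p q α β) where
  norm_nonneg f := ENNReal.toReal_nonneg
  norm_smul c f := by
    have h := (tentENorm_congr p q α β
      (AEEqFun.coeFn_smul c (f : E n × ℝ →ₘ[halfMeasure n] ℝ))).trans
        (tentENorm_smul p hq.out α β c (f : E n × ℝ →ₘ[halfMeasure n] ℝ).measurable)
    refine (congrArg ENNReal.toReal h).trans ?_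
    rw [ENNReal.toReal_mul, toReal_enorm]
    rfl
  norm_triangle f g := by
    have h := (tentENorm_congr p q α β (AEEqFun.coeFn_add
      (f : E n × ℝ →ₘ[halfMeasure n] ℝ) (g : E n × ℝ →ₘ[halfMeasure n] ℝ))).trans_le
        (tentENorm_add_le hp.out hq.out α β (AEEqFun.measurable _) (AEEqFun.measurable _))
    refine (ENNReal.toReal_mono (ENNReal.add_ne_top.2 ⟨f.2.ne, g.2.ne⟩) h).trans_eq ?_
    exact ENNReal.toReal_add f.2.ne g.2.ne
  norm_eq_zero_iff f := by
    constructor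
    · intro h
      have h0 : tentENorm p q α β (f : E n × ℝ →ₘ[halfMeasure n] ℝ) = 0 :=
        ((ENNReal.toReal_eq_zero_iff _).1 h).resolve_right f.2.ne
      refine Subtype.ext (AEEqFun.ext ?_)
      refine Filter.EventuallyEq.trans ?_ AEEqFun.coeFn_zero.symm
      unfold tentENorm at h0
      split_ifs at h0
      · exact ae_eq_zero_of_carlesonFun hq.out hα.out hβ.out (AEEqFun.measurable _) h0
      · exact ae_eq_zero_of_areaFun hp.out hq.out hα.out hβ.out (AEEqFun.measurable _) h0
    · rintro rfl
      have h0 : tentENorm p q α β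
          (((0 : tentSpace n p q α β) : E n × ℝ →ₘ[halfMeasure n] ℝ) : E n × ℝ → ℝ) = 0 :=
        (tentENorm_congr p q α β AEEqFun.coeFn_zero).trans (tentENorm_zero p hq.out α β)
      simp only [norm, h0, ENNReal.toReal_zero]

variable [Fact (0 < α)] [Fact (0 < β)]

instance : NormedAddCommGroup (tentSpace n p q α β) :=
  NormedAddCommGroup.ofCore (𝕜 := ℝ) tentSpace_core

instance : NormedSpace ℝ (tentSpace n p q α β) := NormedSpace.ofCore tentSpace_core

end norm

end GaussTent

end

noncomputable section

namespace GaussTent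

/-! ### Gaussian geometry: the cutoff, local doubling, and Fubini between cones and balls. -/

section basic

variable {n : ℕ} {α β : ℝ}

/-! ### The Gaussian measure and its local doubling property -/

/-! Cones involve only balls whose radius is at most `β` times the cutoff at the centre. On such
balls the Gaussian density is constant up to a factor, so the measure is doubling there
(`exists_gauss_doubling`), and Fubini exchanges integrals over cones for averages over admissible
balls (`lintegral_coneIntegral_mul`). With these two tools the Euclidean arguments for tent spaces
apply. Three things are needed: the pairing is bounded, every functional is given by a function, and
the tent norm of that function is controlled by the functional.

The pairing is bounded by Hölder in each cone and then in the vertex when `p > 1`. When `p = 1`,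
Carleson's stopping argument is used (`exists_lintegral_enorm_mul_le_top`): for each point of the
half-space, at least half of its admissible ball consists of vertices whose area integral of `g`,
truncated at the height of the point, is at most a multiple of the Carleson norm. Keeping only those
vertices costs a factor 2, and then Hölder in the cone suffices.

For the representation, multiplication by a positive weight maps `L^q` of a finite measure boundedly
into the tent space. Radon–Nikodym there yields a kernel valid on functions dominated by the weight
(`IsTentWeight.exists_kernel`); truncation and the Fatou property pass to all functions, as soon as
the pairing is norming (`IsTentWeight.exists_representative`).

The norming property (`IsNormingPairing`) has three cases. For `p = 1` Carleson's condition is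
tested with `|g|^(q'-1)` restricted to a tent. For `1 < p ≤ q` the test function is `|g|^(q'-1)`
times the ball average of `(S_{q'} g)^(p'-q')`, and the strong type inequality for the admissible
maximal function bounds its norm. For `p ≥ q` one has `p' ≤ q'`, so the functionals on `T^{p',q'}`
are already represented by elements of `T^{p,q}`, and Hahn–Banach gives the norming property. -/

instance : IsFiniteMeasure (gauss n) := by
  have h : Integrable (fun v : E n => Real.exp (-‖v‖ ^ 2)) volume := by
    have := GaussianFourier.integrable_cexp_neg_mul_sq_norm_add (V := E n) (b := 1) (by simp) 0 0
    simpa [Complex.norm_exp, ← Complex.ofReal_pow] using this.norm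
  exact isFiniteMeasure_withDensity_ofReal h.2

instance : SigmaFinite dtOverT := by
  unfold dtOverT
  exact SigmaFinite.withDensity_ofReal _

instance : SigmaFinite (halfMeasure n) := by unfold halfMeasure; infer_instance

lemma cutoff_mul_norm_le (x : E n) : cutoff x * ‖x‖ ≤ 1 := by
  unfold cutoff
  split_ifs with h
  · simpa using h
  · exact (one_div_mul_cancel (by linarith)).le

/-- Together with `cutoff_mul_le_two`, this makes the cutoff comparable to `1 / (1 + ‖x‖)`, for
which comparison at nearby points is immediate. -/
lemma one_le_cutoff_mul (x : E n) : 1 ≤ cutoff x * (1 + ‖x‖) := by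
  unfold cutoff
  split_ifs with h
  · simp
  · have : 0 < ‖x‖ := by linarith
    rw [mul_add, one_div_mul_cancel this.ne']
    have : 0 < 1 / ‖x‖ := by positivity
    linarith

lemma cutoff_mul_le_two (x : E n) : cutoff x * (1 + ‖x‖) ≤ 2 := by
  linarith [cutoff_mul_norm_le x, cutoff_le_one x]

/-- The cutoff function is essentially constant on balls of bounded radius. -/
lemma cutoff_le_of_dist_le {x y : E n} {b : ℝ} (hb : 0 ≤ b) (h : dist x y ≤ b) :
    cutoff y ≤ 2 * (1 + b) * cutoff x := by
  have h1 : ‖x‖ ≤ ‖y‖ + b := by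
    have := norm_sub_norm_le x y
    rw [← dist_eq_norm] at this
    linarith
  have hx := cutoff_pos x
  have hy := cutoff_pos y
  have hx2 := one_le_cutoff_mul x
  have hy2 := cutoff_mul_le_two y
  have h2 : 1 + ‖x‖ ≤ (1 + b) * (1 + ‖y‖) := by nlinarith [norm_nonneg y]
  calc cutoff y ≤ cutoff y * (cutoff x * (1 + ‖x‖)) := le_mul_of_one_le_right hy.le hx2
    _ ≤ cutoff y * (cutoff x * ((1 + b) * (1 + ‖y‖))) := by gcongr
    _ = (1 + b) * cutoff x * (cutoff y * (1 + ‖y‖)) := by ring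
    _ ≤ (1 + b) * cutoff x * 2 := by gcongr
    _ = _ := by ring

/-- With `d = b * cutoff c` one has `d ≤ b` and `d * ‖c‖ ≤ b`, so the squared norm changes by at
most `2 * d * ‖c‖ + d ^ 2 ≤ 2 * b + b ^ 2`. The decay `1 / ‖c‖` of the cutoff is exactly what
compensates the factor `‖c‖`. -/
lemma exp_bounds_of_dist_le {c y : E n} {b : ℝ} (h : dist y c ≤ b * cutoff c) (hb : 0 ≤ b) :
    Real.exp (-‖c‖ ^ 2 - (2 * b + b ^ 2)) ≤ Real.exp (-‖y‖ ^ 2) ∧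
      Real.exp (-‖y‖ ^ 2) ≤ Real.exp (-‖c‖ ^ 2 + (2 * b + b ^ 2)) := by
  set d := b * cutoff c
  have h1 : ‖y‖ ≤ ‖c‖ + d := by
    have := norm_sub_norm_le y c
    rw [← dist_eq_norm] at this
    linarith
  have h2 : ‖c‖ ≤ ‖y‖ + d := by
    have := norm_sub_norm_le c y
    rw [← dist_eq_norm, dist_comm] at this
    linarith
  have hd0 : 0 ≤ d := mul_nonneg hb (cutoff_pos c).le
  have hd : d ≤ b := mul_le_of_le_one_right hb (cutoff_le_one c)
  have hdc : d * ‖c‖ ≤ b := by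
    calc d * ‖c‖ = b * (cutoff c * ‖c‖) := by simp only [d]; ring
      _ ≤ b := mul_le_of_le_one_right hb (cutoff_mul_norm_le c)
  have hdd : d ^ 2 ≤ b ^ 2 := by gcongr
  constructor
  · rw [Real.exp_le_exp]
    nlinarith [norm_nonneg y, norm_nonneg c]
  · rw [Real.exp_le_exp]
    rcases le_or_gt ‖c‖ ‖y‖ with hle | hlt
    · nlinarith [norm_nonneg y, norm_nonneg c]
    · nlinarith [norm_nonneg y, norm_nonneg c, mul_nonneg hd0 (norm_nonneg c)]

/-- The Gaussian measure is doubling on balls whose radius is at most a multiple of the cutoff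
function at the centre. -/
lemma exists_gauss_doubling (n : ℕ) {a K : ℝ} (ha : 0 ≤ a) (hK : 1 ≤ K) :
    ∃ D : ℝ≥0∞, D ≠ ∞ ∧ ∀ (c : E n) (r : ℝ), r ≤ a * cutoff c →
      gauss n (Metric.ball c (K * r)) ≤ D * gauss n (Metric.ball c r) := by
  have hK0 : 0 < K := by linarith
  set b := K * a
  have hb : 0 ≤ b := by positivity
  set e := 2 * b + b ^ 2
  -- Both balls lie within `b * cutoff c` of `c`, where the density stays within a factor `exp e` of
  -- its value at `c`, above and below; `K ^ n` is the Lebesgue scaling.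
  refine ⟨ENNReal.ofReal (Real.exp (2 * e)) * ENNReal.ofReal (K ^ n),
    ENNReal.mul_ne_top ENNReal.ofReal_ne_top ENNReal.ofReal_ne_top, fun c r hr => ?_⟩
  rcases le_or_gt r 0 with hr0 | hr0
  · rw [Metric.ball_eq_empty.2 (by nlinarith : K * r ≤ 0)]
    simp
  have hvol : (volume : Measure (E n)) (Metric.ball c (K * r)) =
      ENNReal.ofReal (K ^ n) * volume (Metric.ball c r) := by
    rw [Measure.addHaar_ball_mul_of_pos _ _ hK0, finrank_euclideanSpace, Fintype.card_fin,
      Measure.addHaar_ball_center volume c]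
  have hup : gauss n (Metric.ball c (K * r)) ≤
      ENNReal.ofReal (Real.exp (-‖c‖ ^ 2 + e)) * volume (Metric.ball c (K * r)) := by
    unfold gauss
    rw [withDensity_apply _ measurableSet_ball, ← setLIntegral_const]
    refine setLIntegral_mono measurable_const fun y hy => ENNReal.ofReal_le_ofReal ?_
    refine (exp_bounds_of_dist_le ?_ hb).2
    calc dist y c ≤ K * r := (Metric.mem_ball.1 hy).le
      _ ≤ K * (a * cutoff c) := by gcongr
      _ = b * cutoff c := by simp only [b]; ring
  have hlow : ENNReal.ofReal (Real.exp (-‖c‖ ^ 2 - e)) * volume (Metric.ball c r) ≤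
      gauss n (Metric.ball c r) := by
    unfold gauss
    rw [withDensity_apply _ measurableSet_ball, ← setLIntegral_const]
    refine setLIntegral_mono (by fun_prop) fun y hy => ENNReal.ofReal_le_ofReal ?_
    refine (exp_bounds_of_dist_le ?_ hb).1
    calc dist y c ≤ 1 * r := by rw [one_mul]; exact (Metric.mem_ball.1 hy).le
      _ ≤ K * (a * cutoff c) := by gcongr
      _ = b * cutoff c := by simp only [b]; ring
  calc gauss n (Metric.ball c (K * r))
      ≤ ENNReal.ofReal (Real.exp (-‖c‖ ^ 2 + e)) *
        (ENNReal.ofReal (K ^ n) * volume (Metric.ball c r)) := hvol ▸ hup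
    _ = ENNReal.ofReal (Real.exp (2 * e)) * ENNReal.ofReal (K ^ n) *
        (ENNReal.ofReal (Real.exp (-‖c‖ ^ 2 - e)) * volume (Metric.ball c r)) := by
      rw [show -‖c‖ ^ 2 + e = 2 * e + (-‖c‖ ^ 2 - e) by ring, Real.exp_add,
        ENNReal.ofReal_mul (Real.exp_pos _).le]
      ring
    _ ≤ _ := by gcongr

/-! ### Averages over admissible balls and integrals over cones -/

/-- The measure of the admissible ball attached to a point of the half-space. -/
def ballMass (α β : ℝ) (z : E n × ℝ) : ℝ≥0∞ := gauss n (Metric.ball z.1 (rad α β z.1 z.2))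

/-- The average over the admissible ball attached to a point of the half-space. -/
def ballAverage (α β : ℝ) (h : E n → ℝ≥0∞) (z : E n × ℝ) : ℝ≥0∞ :=
  (ballMass α β z)⁻¹ * ∫⁻ x in Metric.ball z.1 (rad α β z.1 z.2), h x ∂(gauss n)

/-- The integral over a cone, with the normalization of the area function. -/
def coneIntegral (α β : ℝ) (F : E n × ℝ → ℝ≥0∞) (x : E n) : ℝ≥0∞ :=
  ∫⁻ z in cone α β x, F z / ballMass α β z ∂(halfMeasure n)

lemma areaFun_eq (q : ℝ) (f : E n × ℝ → ℝ) (x : E n) :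
    areaFun q α β f x = (coneIntegral α β (fun z => ‖f z‖ₑ ^ q) x) ^ (1 / q) := rfl

lemma areaFun_rpow {q : ℝ} (hq : 0 < q) (f : E n × ℝ → ℝ) (x : E n) :
    areaFun q α β f x ^ q = coneIntegral α β (fun z => ‖f z‖ₑ ^ q) x := by
  rw [areaFun_eq, ← ENNReal.rpow_mul, one_div_mul_cancel hq.ne', ENNReal.rpow_one]

lemma measurable_ballMass : Measurable (ballMass (n := n) α β) := measurable_weight α β

lemma ballMass_ne_top (z : E n × ℝ) : ballMass α β z ≠ ∞ := (gauss_ball_lt_top _ _).ne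

lemma ballMass_ne_zero (hα : 0 < α) (hβ : 0 < β) {z : E n × ℝ} (hz : 0 < z.2) :
    ballMass α β z ≠ 0 := (gauss_ball_pos _ (rad_pos hα hβ _ hz)).ne'

/-- The incidence relation behind every use of Fubini: the vertices of the cones through a point of
the half-space form its admissible ball. -/
lemma mem_cone_iff {x : E n} {z : E n × ℝ} :
    z ∈ cone α β x ↔ 0 < z.2 ∧ x ∈ Metric.ball z.1 (rad α β z.1 z.2) := by
  simp [cone, dist_comm]

lemma measurable_coneIntegral {F : E n × ℝ → ℝ≥0∞} (hF : Measurable F) :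
    Measurable (coneIntegral α β F) := by
  unfold coneIntegral
  simp_rw [← lintegral_indicator (measurableSet_cone α β _)]
  exact (measurable_kernel α β (hF.div measurable_ballMass)).lintegral_prod_right'

lemma measurable_setLIntegral_ball {G : E n × (E n × ℝ) → ℝ≥0∞} (hG : Measurable G) :
    Measurable fun z : E n × ℝ =>
      ∫⁻ x in Metric.ball z.1 (rad α β z.1 z.2), G (x, z) ∂(gauss n) := by
  simp_rw [← lintegral_indicator measurableSet_ball]
  have h : Measurable fun w : E n × (E n × ℝ) =>
      {w : E n × (E n × ℝ) | dist w.1 w.2.1 < rad α β w.2.1 w.2.2}.indicator G w := by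
    refine hG.indicator (measurableSet_lt ?_ ((measurable_rad α β).comp measurable_snd))
    exact measurable_fst.dist (measurable_fst.comp measurable_snd)
  exact h.lintegral_prod_left'

lemma measurable_ballAverage {h : E n → ℝ≥0∞} (hh : Measurable h) :
    Measurable (ballAverage α β h) :=
  measurable_ballMass.inv.mul (measurable_setLIntegral_ball (hh.comp measurable_fst))

/-- Fubini's theorem for the incidence relation between points and cones. -/
lemma lintegral_cone_swap {G : E n × (E n × ℝ) → ℝ≥0∞} (hG : Measurable G) :
    ∫⁻ x, ∫⁻ z in cone α β x, G (x, z) / ballMass α β z ∂(halfMeasure n) ∂(gauss n) =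
      ∫⁻ z, (ballMass α β z)⁻¹ *
        ∫⁻ x in Metric.ball z.1 (rad α β z.1 z.2), G (x, z) ∂(gauss n) ∂(halfMeasure n) := by
  simp_rw [← lintegral_indicator (measurableSet_cone α β _)]
  have hm : Measurable fun w : E n × (E n × ℝ) =>
      (cone α β w.1).indicator (fun z => G (w.1, z) / ballMass α β z) w.2 := by
    have := (hG.div (measurable_ballMass (α := α) (β := β).comp measurable_snd)).indicator
      (measurableSet_cone' (n := n) α β)
    convert this using 1
    funext w
    by_cases hw : w.2 ∈ cone α β w.1 <;> simp [indicator, hw]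
  rw [lintegral_lintegral_swap hm.aemeasurable]
  refine lintegral_congr_ae ?_
  filter_upwards [ae_pos] with z hz
  rw [← lintegral_indicator measurableSet_ball, ← lintegral_const_mul]
  · refine lintegral_congr fun x => ?_
    by_cases hx : x ∈ Metric.ball z.1 (rad α β z.1 z.2)
    · rw [indicator_of_mem (mem_cone_iff.2 ⟨hz, hx⟩), indicator_of_mem hx, mul_comm, div_eq_mul_inv]
    · rw [indicator_of_notMem (fun h => hx (mem_cone_iff.1 h).2), indicator_of_notMem hx, mul_zero]
  · exact (hG.comp (measurable_id.prodMk measurable_const)).indicator measurableSet_ball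

/-- Integration over cones is dual to averaging over balls. -/
lemma lintegral_coneIntegral_mul {F : E n × ℝ → ℝ≥0∞} (hF : Measurable F) {h : E n → ℝ≥0∞}
    (hh : Measurable h) :
    ∫⁻ x, coneIntegral α β F x * h x ∂(gauss n) =
      ∫⁻ z, F z * ballAverage α β h z ∂(halfMeasure n) := by
  have := lintegral_cone_swap (α := α) (β := β) (G := fun w => F w.2 * h w.1)
    ((hF.comp measurable_snd).mul (hh.comp measurable_fst))
  convert this using 1
  · refine lintegral_congr fun x => ?_
    unfold coneIntegral
    rw [mul_comm, ← lintegral_const_mul _ (by exact hF.div measurable_ballMass)]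
    refine lintegral_congr fun z => ?_
    simp only [div_eq_mul_inv]
    ring
  · refine lintegral_congr fun z => ?_
    simp only [ballAverage]
    rw [lintegral_const_mul _ hh]
    ring

lemma ballAverage_le_of_le {h : E n → ℝ≥0∞} {b : ℝ≥0∞} (hb : ∀ x, h x ≤ b) (z : E n × ℝ) :
    ballAverage α β h z ≤ b := by
  unfold ballAverage
  calc _ ≤ (ballMass α β z)⁻¹ * ∫⁻ _ in Metric.ball z.1 (rad α β z.1 z.2), b ∂(gauss n) := by
        gcongr; exact hb _
    _ = b * ((ballMass α β z)⁻¹ * ballMass α β z) := by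
        rw [setLIntegral_const, ballMass]; ring
    _ ≤ b * 1 := by gcongr; exact ENNReal.inv_mul_le_one _
    _ = b := mul_one b

lemma ballAverage_one (hα : 0 < α) (hβ : 0 < β) {z : E n × ℝ} (hz : 0 < z.2) :
    ballAverage α β (fun _ => 1) z = 1 := by
  simp only [ballAverage, setLIntegral_const, one_mul]
  exact ENNReal.inv_mul_cancel (ballMass_ne_zero hα hβ hz) (ballMass_ne_top z)

/-- Dividing by `ballMass` in the cone integral makes this an exact identity, since the average of 1
is 1. -/
lemma lintegral_coneIntegral (hα : 0 < α) (hβ : 0 < β) {F : E n × ℝ → ℝ≥0∞}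
    (hF : Measurable F) :
    ∫⁻ x, coneIntegral α β F x ∂(gauss n) = ∫⁻ z, F z ∂(halfMeasure n) := by
  have := lintegral_coneIntegral_mul (α := α) (β := β) hF (h := fun _ => 1) measurable_const
  simp only [mul_one] at this
  rw [this]
  refine lintegral_congr_ae ?_
  filter_upwards [ae_pos] with z hz
  rw [ballAverage_one hα hβ hz, mul_one]

end basic

section maximal

variable {n : ℕ} {α β : ℝ}

/-! ### The maximal function over admissible balls -/

/-- The strong type inequality from a restricted weak type inequality, for functions with finite
values. -/
lemma lintegral_rpow_le_of_weak_type {X : Type*} [MeasurableSpace X] {ν : Measure X} [SFinite ν]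
    {u h : X → ℝ≥0∞} (hu : Measurable u) (hh : Measurable h) (hut : ∀ x, u x ≠ ∞)
    (hht : ∀ x, h x ≠ ∞) {D : ℝ≥0∞} {s : ℝ} (hs : 1 < s)
    (hw : ∀ r : ℝ, 0 < r →
      ν {x | ENNReal.ofReal r < u x} ≤ D / ENNReal.ofReal r *
        ∫⁻ x in {x | ENNReal.ofReal r < 2 * h x}, h x ∂ν) :
    ∫⁻ x, u x ^ s ∂ν ≤
      ENNReal.ofReal s * D * (ENNReal.ofReal (s - 1))⁻¹ * 2 ^ (s - 1) * ∫⁻ x, h x ^ s ∂ν := by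
  have hs0 : 0 < s := by linarith
  have hs1 : 0 < s - 1 := by linarith
  have h1 : ∫⁻ x, u x ^ s ∂ν = ENNReal.ofReal s * ∫⁻ r in Ioi (0 : ℝ),
      ν {x | ENNReal.ofReal r < u x} * ENNReal.ofReal (r ^ (s - 1)) := by
    have := lintegral_rpow_eq_lintegral_meas_lt_mul ν (f := fun x => (u x).toReal)
      (Filter.Eventually.of_forall fun x => ENNReal.toReal_nonneg) hu.ennreal_toReal.aemeasurable
      hs0
    convert this using 2
    · funext x
      rw [← ENNReal.ofReal_rpow_of_nonneg ENNReal.toReal_nonneg hs0.le,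
        ENNReal.ofReal_toReal (hut x)]
    · refine setLIntegral_congr_fun measurableSet_Ioi fun r hr => ?_
      simp only [ENNReal.ofReal_lt_iff_lt_toReal (le_of_lt hr) (hut _)]
  -- Layer cake for `2 * h` with respect to the measure `h dν`: this is the integral that appears
  -- when the weak type bound is inserted in the layer cake formula for `u`.
  have h2 : ∫⁻ x, (2 * h x) ^ (s - 1) * h x ∂ν = ENNReal.ofReal (s - 1) *
      ∫⁻ r in Ioi (0 : ℝ), (∫⁻ x in {x | ENNReal.ofReal r < 2 * h x}, h x ∂ν) *
        ENNReal.ofReal (r ^ (s - 1 - 1)) := by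
    have h2t : ∀ x, 2 * h x ≠ ∞ := fun x => ENNReal.mul_ne_top (by simp) (hht x)
    have := lintegral_rpow_eq_lintegral_meas_lt_mul (ν.withDensity h)
      (f := fun x => (2 * h x).toReal)
      (Filter.Eventually.of_forall fun x => ENNReal.toReal_nonneg)
      (hh.const_mul 2).ennreal_toReal.aemeasurable hs1
    rw [lintegral_withDensity_eq_lintegral_mul _ hh
      ((hh.const_mul 2).ennreal_toReal.pow_const _).ennreal_ofReal] at this
    convert this using 2
    · funext x
      rw [Pi.mul_apply, ← ENNReal.ofReal_rpow_of_nonneg ENNReal.toReal_nonneg hs1.le,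
        ENNReal.ofReal_toReal (h2t x), mul_comm]
    · refine setLIntegral_congr_fun measurableSet_Ioi fun r hr => ?_
      simp only [ENNReal.ofReal_lt_iff_lt_toReal (le_of_lt hr) (h2t _)]
      rw [withDensity_apply]
      exact measurableSet_lt measurable_const (hh.const_mul 2).ennreal_toReal
  have h3 : ∫⁻ r in Ioi (0 : ℝ), ν {x | ENNReal.ofReal r < u x} * ENNReal.ofReal (r ^ (s - 1)) ≤
      D * ∫⁻ r in Ioi (0 : ℝ), (∫⁻ x in {x | ENNReal.ofReal r < 2 * h x}, h x ∂ν) *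
        ENNReal.ofReal (r ^ (s - 1 - 1)) := by
    rw [← lintegral_const_mul]
    · refine setLIntegral_mono' measurableSet_Ioi fun r hr => ?_
      have hr' : 0 < r := hr
      have e : ENNReal.ofReal (r ^ (s - 1)) =
          ENNReal.ofReal r * ENNReal.ofReal (r ^ (s - 1 - 1)) := by
        rw [← ENNReal.ofReal_mul hr'.le, Real.rpow_sub_one hr'.ne' (s - 1),
          mul_div_cancel₀ _ hr'.ne']
      have hr2 : ENNReal.ofReal r ≠ 0 := by simpa using hr'
      calc _ ≤ D / ENNReal.ofReal r * (∫⁻ x in {x | ENNReal.ofReal r < 2 * h x}, h x ∂ν) *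
            (ENNReal.ofReal r * ENNReal.ofReal (r ^ (s - 1 - 1))) := by
            rw [e]; gcongr; exact hw r hr'
        _ = D / ENNReal.ofReal r * ENNReal.ofReal r *
            ((∫⁻ x in {x | ENNReal.ofReal r < 2 * h x}, h x ∂ν) *
              ENNReal.ofReal (r ^ (s - 1 - 1))) := by ring
        _ = _ := by rw [ENNReal.div_mul_cancel hr2 ENNReal.ofReal_ne_top]
    · refine Measurable.mul ?_ (by fun_prop)
      have hm : Measurable fun w : ℝ × X =>
          {w : ℝ × X | ENNReal.ofReal w.1 < 2 * h w.2}.indicator (fun w => h w.2) w :=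
        (hh.comp measurable_snd).indicator (measurableSet_lt
          (ENNReal.measurable_ofReal.comp measurable_fst) ((hh.comp measurable_snd).const_mul 2))
      have hm2 := hm.lintegral_prod_right' (ν := ν)
      simp_rw [← lintegral_indicator (measurableSet_lt measurable_const (hh.const_mul 2))]
      exact hm2
  have hne : ENNReal.ofReal (s - 1) ≠ 0 := by simpa using hs1
  have h4 : ∫⁻ x, (2 * h x) ^ (s - 1) * h x ∂ν = 2 ^ (s - 1) * ∫⁻ x, h x ^ s ∂ν := by
    rw [← lintegral_const_mul _ (hh.pow_const s)]
    refine lintegral_congr fun x => ?_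
    rw [ENNReal.mul_rpow_of_nonneg _ _ hs1.le, mul_assoc]
    congr 1
    conv_lhs => rw [← ENNReal.rpow_one (h x), ← ENNReal.rpow_mul,
      ← ENNReal.rpow_add_of_nonneg _ _ (by linarith) zero_le_one]
    congr 1
    ring
  rw [h1]
  calc _ ≤ ENNReal.ofReal s * (D * ∫⁻ r in Ioi (0 : ℝ),
        (∫⁻ x in {x | ENNReal.ofReal r < 2 * h x}, h x ∂ν) *
          ENNReal.ofReal (r ^ (s - 1 - 1))) := by gcongr
    _ = ENNReal.ofReal s * D * ((ENNReal.ofReal (s - 1))⁻¹ *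
        ∫⁻ x, (2 * h x) ^ (s - 1) * h x ∂ν) := by
      rw [h2, ← mul_assoc (ENNReal.ofReal (s - 1))⁻¹, ENNReal.inv_mul_cancel hne
        ENNReal.ofReal_ne_top, one_mul, mul_assoc]
    _ = _ := by rw [h4]; ring

/-- The maximal function over the admissible balls containing a point. -/
def admMaximal (α β : ℝ) (h : E n → ℝ≥0∞) (x : E n) : ℝ≥0∞ :=
  ⨆ z ∈ cone α β x, ballAverage α β h z

lemma ballAverage_le_admMaximal (h : E n → ℝ≥0∞) {x : E n} {z : E n × ℝ} (hz : z ∈ cone α β x) :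
    ballAverage α β h z ≤ admMaximal α β h x :=
  le_iSup₂_of_le z hz le_rfl

lemma admMaximal_le_of_le {h : E n → ℝ≥0∞} {b : ℝ≥0∞} (hb : ∀ x, h x ≤ b) (x : E n) :
    admMaximal α β h x ≤ b :=
  iSup₂_le fun z _ => ballAverage_le_of_le hb z

/-- Superlevel sets are unions of open balls. This gives measurability without any condition on `h`,
and it supplies the family of balls for Vitali's covering lemma. -/
lemma setOf_lt_admMaximal (h : E n → ℝ≥0∞) (r : ℝ≥0∞) :
    {x | r < admMaximal α β h x} =
      ⋃ z ∈ {z : E n × ℝ | 0 < z.2 ∧ r < ballAverage α β h z},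
        Metric.ball z.1 (rad α β z.1 z.2) := by
  ext x
  simp only [admMaximal, mem_ofPred_eq, lt_iSup_iff, mem_iUnion, exists_prop, mem_cone_iff]
  exact ⟨fun ⟨z, hz, h⟩ => ⟨z, ⟨hz.1, h⟩, hz.2⟩, fun ⟨z, hz, h⟩ => ⟨z, ⟨hz.1, h⟩, hz.2⟩⟩

lemma measurable_admMaximal (h : E n → ℝ≥0∞) : Measurable (admMaximal α β h) := by
  refine measurable_of_Ioi fun r => IsOpen.measurableSet ?_
  change IsOpen {x | r < admMaximal α β h x}
  rw [setOf_lt_admMaximal]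
  exact isOpen_biUnion fun _ _ => Metric.isOpen_ball

lemma rad_le (α : ℝ) (hβ : 0 < β) (y : E n) (t : ℝ) : rad α β y t ≤ β :=
  (min_le_right _ _).trans (mul_le_of_le_one_right hβ.le (cutoff_le_one _))

/-- The weak type inequality for the admissible maximal function. -/
lemma exists_admMaximal_weak_type (n : ℕ) (hα : 0 < α) (hβ : 0 < β) :
    ∃ D : ℝ≥0∞, D ≠ ∞ ∧ ∀ (h : E n → ℝ≥0∞) (r : ℝ≥0∞),
      r * gauss n {x | r < admMaximal α β h x} ≤ D * ∫⁻ x, h x ∂(gauss n) := by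
  obtain ⟨D, hD, hdoub⟩ := exists_gauss_doubling n hβ.le (show (1 : ℝ) ≤ 4 by norm_num)
  refine ⟨D, hD, fun h r => ?_⟩
  set t := {z : E n × ℝ | 0 < z.2 ∧ r < ballAverage α β h z}
  -- The radii are bounded by `β`, so Vitali's lemma selects disjoint balls whose enlargements by 4
  -- cover; local doubling absorbs the enlargement.
  obtain ⟨u, hut, hdisj, hcov⟩ := Vitali.exists_disjoint_subfamily_covering_enlargement_ball t
    (fun z => z.1) (fun z => rad α β z.1 z.2) β (fun z _ => rad_le α hβ _ _) 4 (by norm_num)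
  have hc : u.Countable := hdisj.countable_of_isOpen (fun _ _ => Metric.isOpen_ball) fun z hz =>
    ⟨z.1, Metric.mem_ball_self (rad_pos hα hβ _ (hut hz).1)⟩
  have hsub : {x | r < admMaximal α β h x} ⊆
      ⋃ z ∈ u, Metric.ball z.1 (4 * rad α β z.1 z.2) := by
    rw [setOf_lt_admMaximal]
    refine iUnion₂_subset fun z hz => ?_
    obtain ⟨b, hb, hzb⟩ := hcov z hz
    exact hzb.trans (subset_biUnion_of_mem (u := fun z : E n × ℝ =>
      Metric.ball z.1 (4 * rad α β z.1 z.2)) hb)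
  have hterm : ∀ z ∈ u, r * gauss n (Metric.ball z.1 (4 * rad α β z.1 z.2)) ≤
      D * ∫⁻ x in Metric.ball z.1 (rad α β z.1 z.2), h x ∂(gauss n) := fun z hz => by
    have hlt : r * ballMass α β z ≤
        ∫⁻ x in Metric.ball z.1 (rad α β z.1 z.2), h x ∂(gauss n) := by
      rw [← ENNReal.le_div_iff_mul_le (.inl (ballMass_ne_zero hα hβ (hut hz).1))
        (.inl (ballMass_ne_top z)), ENNReal.div_eq_inv_mul]
      exact (hut hz).2.le
    calc _ ≤ r * (D * ballMass α β z) := by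
          gcongr; exact hdoub _ _ (min_le_right _ _)
      _ = D * (r * ballMass α β z) := by ring
      _ ≤ _ := by gcongr
  calc r * gauss n {x | r < admMaximal α β h x}
      ≤ r * ∑' z : u, gauss n (Metric.ball z.1.1 (4 * rad α β z.1.1 z.1.2)) := by
        gcongr
        exact (measure_mono hsub).trans (measure_biUnion_le _ hc _)
    _ = ∑' z : u, r * gauss n (Metric.ball z.1.1 (4 * rad α β z.1.1 z.1.2)) :=
        ENNReal.tsum_mul_left.symm
    _ ≤ ∑' z : u, D * ∫⁻ x in Metric.ball z.1.1 (rad α β z.1.1 z.1.2), h x ∂(gauss n) :=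
        ENNReal.tsum_le_tsum fun z => hterm z.1 z.2
    _ = D * ∫⁻ x in ⋃ z ∈ u, Metric.ball z.1 (rad α β z.1 z.2), h x ∂(gauss n) := by
        rw [ENNReal.tsum_mul_left, lintegral_biUnion hc (fun _ _ => measurableSet_ball) hdisj]
    _ ≤ _ := by gcongr; exact Measure.restrict_le_self

/-- The strong type inequality for the admissible maximal function. -/
lemma exists_admMaximal_strong_type (n : ℕ) (hα : 0 < α) (hβ : 0 < β) {s : ℝ} (hs : 1 < s) :
    ∃ C : ℝ≥0∞, C ≠ ∞ ∧ ∀ h : E n → ℝ≥0∞, Measurable h → (∃ b : ℝ≥0∞, b ≠ ∞ ∧ ∀ x, h x ≤ b) →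
      ∫⁻ x, admMaximal α β h x ^ s ∂(gauss n) ≤ C * ∫⁻ x, h x ^ s ∂(gauss n) := by
  obtain ⟨D, hD, hweak⟩ := exists_admMaximal_weak_type n hα hβ
  have hs1 : 0 < s - 1 := by linarith
  refine ⟨ENNReal.ofReal s * (2 * D) * (ENNReal.ofReal (s - 1))⁻¹ * 2 ^ (s - 1), ?_,
    fun h hh ⟨b, hb, hhb⟩ => ?_⟩
  · refine ENNReal.mul_ne_top (ENNReal.mul_ne_top (ENNReal.mul_ne_top ENNReal.ofReal_ne_top
      (ENNReal.mul_ne_top (by simp) hD)) ?_) (ENNReal.rpow_ne_top_of_nonneg hs1.le (by simp))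
    simpa using hs1
  refine lintegral_rpow_le_of_weak_type (measurable_admMaximal h) hh
    (fun x => ((admMaximal_le_of_le hhb x).trans_lt hb.lt_top).ne)
    (fun x => ((hhb x).trans_lt hb.lt_top).ne) hs fun r hr => ?_
  -- Off `A` the function is at most `r / 2`, and so is its contribution to every average. Where the
  -- maximal function of `h` exceeds `r`, that of `h` cut to `A` exceeds `r / 2`; this halving
  -- accounts for `2 * D`.
  set A := {x | ENNReal.ofReal r < 2 * h x}
  have hA : MeasurableSet A := measurableSet_lt measurable_const (hh.const_mul 2)
  have hr0 : ENNReal.ofReal r ≠ 0 := by simpa using hr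
  have hpt : ∀ x, h x ≤ A.indicator h x + ENNReal.ofReal r / 2 := fun x => by
    by_cases hx : x ∈ A
    · rw [indicator_of_mem hx]; exact le_self_add
    · rw [indicator_of_notMem hx, zero_add, ENNReal.le_div_iff_mul_le (by simp) (by simp),
        mul_comm]
      exact not_lt.1 hx
  have havg : ∀ z, ballAverage α β h z ≤
      ballAverage α β (A.indicator h) z + ENNReal.ofReal r / 2 := fun z => by
    calc ballAverage α β h z
        ≤ ballAverage α β (fun x => A.indicator h x + ENNReal.ofReal r / 2) z := by
          unfold ballAverage; gcongr; exact hpt _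
      _ = ballAverage α β (A.indicator h) z +
          ballAverage α β (fun _ => ENNReal.ofReal r / 2) z := by
          unfold ballAverage
          rw [lintegral_add_right _ measurable_const, mul_add]
      _ ≤ _ := by gcongr; exact ballAverage_le_of_le (fun _ => le_rfl) z
  have hsub : {x | ENNReal.ofReal r < admMaximal α β h x} ⊆
      {x | ENNReal.ofReal r / 2 < admMaximal α β (A.indicator h) x} := fun x hx => by
    have h1 : admMaximal α β h x ≤ admMaximal α β (A.indicator h) x + ENNReal.ofReal r / 2 :=
      iSup₂_le fun z hz => (havg z).trans (by gcongr; exact ballAverage_le_admMaximal _ hz)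
    have h2 : ENNReal.ofReal r / 2 + ENNReal.ofReal r / 2 <
        admMaximal α β (A.indicator h) x + ENNReal.ofReal r / 2 := by
      rw [ENNReal.add_halves]; exact lt_of_lt_of_le hx h1
    exact lt_of_add_lt_add_right h2
  have h3 := hweak (A.indicator h) (ENNReal.ofReal r / 2)
  rw [lintegral_indicator hA] at h3
  have hr2 : ENNReal.ofReal r / 2 ≠ 0 := by simpa using hr
  have hr3 : ENNReal.ofReal r / 2 ≠ ∞ := (ENNReal.div_lt_top ENNReal.ofReal_ne_top (by simp)).ne
  calc _ ≤ gauss n {x | ENNReal.ofReal r / 2 < admMaximal α β (A.indicator h) x} :=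
        measure_mono hsub
    _ ≤ (D * ∫⁻ x in A, h x ∂(gauss n)) / (ENNReal.ofReal r / 2) := by
        rw [ENNReal.le_div_iff_mul_le (.inl hr2) (.inl hr3), mul_comm]
        exact h3
    _ = _ := by
        rw [div_eq_mul_inv, div_eq_mul_inv, div_eq_mul_inv, ENNReal.mul_inv (.inl hr0) (by simp),
          inv_inv]
        ring

end maximal

/-! ### Boundedness of the pairing, including Carleson's argument at the endpoint. -/

section pairing

variable {n : ℕ} {α β : ℝ}

/-! ### The duality pairing is bounded -/

lemma tentENorm_of_ne_top {p : ℝ≥0∞} (hp0 : p ≠ 0) (hp : p ≠ ∞) (q : ℝ) (f : E n × ℝ → ℝ) :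
    tentENorm p q α β f = (∫⁻ x, areaFun q α β f x ^ p.toReal ∂(gauss n)) ^ (1 / p.toReal) := by
  unfold tentENorm
  rw [if_neg hp, eLpNorm_eq_lintegral_rpow_enorm_toReal hp0 hp]
  simp only [enorm_eq_self]

lemma tentENorm_top (q : ℝ) (f : E n × ℝ → ℝ) :
    tentENorm ∞ q α β f = eLpNorm (carlesonFun q α β f) ∞ (gauss n) := if_pos rfl

/-- Hölder's inequality on a part of a cone. -/
lemma setLIntegral_weighted_holder {q q' : ℝ} (hq : q.HolderConjugate q') {f g : E n × ℝ → ℝ}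
    (hf : Measurable f) (hg : Measurable g) (s : Set (E n × ℝ)) :
    ∫⁻ z in s, ‖f z‖ₑ * ‖g z‖ₑ / ballMass α β z ∂(halfMeasure n) ≤
      (∫⁻ z in s, ‖f z‖ₑ ^ q / ballMass α β z ∂(halfMeasure n)) ^ (1 / q) *
        (∫⁻ z in s, ‖g z‖ₑ ^ q' / ballMass α β z ∂(halfMeasure n)) ^ (1 / q') := by
  have key : ∀ {r : ℝ} (_ : 0 < r) (a b : ℝ≥0∞), a ^ r / b = (a * (b⁻¹) ^ (1 / r)) ^ r :=
    fun {r} hr a b => by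
      rw [ENNReal.mul_rpow_of_nonneg _ _ hr.le, ← ENNReal.rpow_mul, one_div_mul_cancel hr.ne',
        ENNReal.rpow_one, div_eq_mul_inv]
  simp only [key hq.pos, key hq.symm.pos]
  refine le_trans (le_of_eq ?_) (ENNReal.lintegral_mul_le_Lp_mul_Lq _ hq
    (f := fun z => ‖f z‖ₑ * (ballMass α β z)⁻¹ ^ (1 / q))
    (g := fun z => ‖g z‖ₑ * (ballMass α β z)⁻¹ ^ (1 / q'))
    (hf.enorm.mul (measurable_ballMass.inv.pow_const _)).aemeasurable
    (hg.enorm.mul (measurable_ballMass.inv.pow_const _)).aemeasurable)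
  refine lintegral_congr fun z => ?_
  have h1 : (ballMass α β z)⁻¹ = (ballMass α β z)⁻¹ ^ (1 / q) * (ballMass α β z)⁻¹ ^ (1 / q') := by
    rw [← ENNReal.rpow_add_of_nonneg _ _ hq.one_div_nonneg hq.symm.one_div_nonneg, one_div, one_div,
      hq.inv_add_inv_eq_one, ENNReal.rpow_one]
  rw [div_eq_mul_inv, Pi.mul_apply]
  nth_rewrite 1 [h1]
  ring

/-- The integral over the half-space is the integral over all vertices of the cone integrals, and
Hölder applies in each cone. -/
lemma lintegral_enorm_mul_le_areaFun (hα : 0 < α) (hβ : 0 < β) {q q' : ℝ}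
    (hq : q.HolderConjugate q') {f g : E n × ℝ → ℝ} (hf : Measurable f) (hg : Measurable g) :
    ∫⁻ z, ‖f z‖ₑ * ‖g z‖ₑ ∂(halfMeasure n) ≤
      ∫⁻ x, areaFun q α β f x * areaFun q' α β g x ∂(gauss n) := by
  rw [← lintegral_coneIntegral hα hβ (F := fun z => ‖f z‖ₑ * ‖g z‖ₑ) (hf.enorm.mul hg.enorm)]
  exact lintegral_mono fun x => setLIntegral_weighted_holder hq hf hg _

/-- The pairing is bounded in the reflexive range, by Hölder's inequality. -/
lemma lintegral_enorm_mul_le_of_ne_top (hα : 0 < α) (hβ : 0 < β) {p p' : ℝ≥0∞} (hp : p ≠ ∞)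
    (hp' : p' ≠ ∞) (hpp' : p.HolderConjugate p') {q q' : ℝ} (hq : q.HolderConjugate q')
    {f g : E n × ℝ → ℝ} (hf : Measurable f) (hg : Measurable g) :
    ∫⁻ z, ‖f z‖ₑ * ‖g z‖ₑ ∂(halfMeasure n) ≤
      tentENorm p q α β f * tentENorm p' q' α β g := by
  have hp0 : p ≠ 0 := ENNReal.HolderConjugate.ne_zero p p'
  have hp0' : p' ≠ 0 := ENNReal.HolderConjugate.ne_zero p' p
  have hr := ENNReal.HolderConjugate.toReal_of_ne_top hp hp'
  refine (lintegral_enorm_mul_le_areaFun hα hβ hq hf hg).trans ?_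
  rw [tentENorm_of_ne_top hp0 hp, tentENorm_of_ne_top hp0' hp']
  exact ENNReal.lintegral_mul_le_Lp_mul_Lq _ hr (measurable_areaFun q α β hf).aemeasurable
    (measurable_areaFun q' α β hg).aemeasurable

/-! ### Tents and Carleson's condition -/

/-- A tent is defined through an uncountable union; the distance to the complement makes it
measurable. The extended distance is infinite when the complement is empty, so the whole space needs
no separate case. -/
lemma tent_eq (O : Set (E n)) :
    tent α β O = {z | 0 < z.2 ∧ ¬ Metric.infEDist z.1 Oᶜ < ENNReal.ofReal (rad α β z.1 z.2)} := by
  ext z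
  simp only [tent, mem_sdiff, mem_ofPred_eq, mem_iUnion, Metric.infEDist_lt_iff, exists_prop,
    cone, edist_lt_ofReal, and_congr_right_iff]
  intro hz
  simp only [hz, true_and]

lemma measurableSet_tent (O : Set (E n)) : MeasurableSet (tent α β O) := by
  rw [tent_eq]
  refine (measurableSet_lt measurable_const measurable_snd).inter (MeasurableSet.compl ?_)
  exact measurableSet_lt (Metric.continuous_infEDist.measurable.comp measurable_fst)
    (ENNReal.measurable_ofReal.comp (measurable_rad α β))

lemma mem_of_mem_tent {O : Set (E n)} {z : E n × ℝ} (hz : z ∈ tent α β O) {x : E n}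
    (hx : z ∈ cone α β x) : x ∈ O := by
  by_contra hxO
  exact hz.2 (mem_biUnion (show x ∈ Oᶜ from hxO) hx)

/-- Carleson's condition on all tents over balls, from the bound on the Carleson functional. -/
lemma setLIntegral_tent_le (hα : 0 < α) (hβ : 0 < β) {q : ℝ} (hq : 0 < q) (g : E n × ℝ → ℝ)
    (c : E n) {r : ℝ} (hr : 0 < r) :
    ∫⁻ z in tent α β (Metric.ball c r), ‖g z‖ₑ ^ q ∂(halfMeasure n) ≤
      tentENorm ∞ q α β g ^ q * gauss n (Metric.ball c r) := by
  rw [tentENorm_top, eLpNorm_exponent_top]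
  -- The points `x` for which the given ball competes in the supremum form a ball of positive
  -- measure, so at one of them the essential bound is attained as a pointwise bound.
  obtain ⟨x, hx, hxN⟩ : ∃ x ∈ Metric.ball c (rad α β c r),
      carlesonFun q α β g x ≤ eLpNormEssSup (carlesonFun q α β g) (gauss n) := by
    by_contra! hcon
    have hpos : 0 < gauss n (Metric.ball c (rad α β c r)) := gauss_ball_pos c (rad_pos hα hβ c hr)
    refine hpos.ne' (measure_mono_null (fun x hx => not_le.2 (hcon x hx)) (ae_iff.1 ?_))
    simpa using ae_le_eLpNormEssSup (f := carlesonFun q α β g) (μ := gauss n)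
  have h1 : ((gauss n (Metric.ball c r))⁻¹ *
      ∫⁻ z in tent α β (Metric.ball c r), ‖g z‖ₑ ^ q ∂(halfMeasure n)) ^ (1 / q) ≤
        eLpNormEssSup (carlesonFun q α β g) (gauss n) := by
    refine le_trans ?_ hxN
    unfold carlesonFun
    exact le_iSup_of_le c (le_iSup_of_le r (le_iSup_of_le hr (le_iSup_of_le hx le_rfl)))
  rw [one_div, ENNReal.rpow_inv_le_iff hq, mul_comm, ← div_eq_mul_inv,
    ENNReal.div_le_iff (gauss_ball_pos c hr).ne' (gauss_ball_lt_top c r).ne] at h1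
  exact h1

/-- Converse to `setLIntegral_tent_le`. Through the two, the endpoint norm is handled by integrals
over tents alone. -/
lemma tentENorm_top_le {q : ℝ} (hq : 0 < q) {g : E n × ℝ → ℝ} {L : ℝ≥0∞}
    (h : ∀ (c : E n) (r : ℝ), 0 < r →
      ∫⁻ z in tent α β (Metric.ball c r), ‖g z‖ₑ ^ q ∂(halfMeasure n) ≤
        L ^ q * gauss n (Metric.ball c r)) :
    tentENorm ∞ q α β g ≤ L := by
  rw [tentENorm_top, eLpNorm_exponent_top]
  refine eLpNormEssSup_le_of_ae_enorm_bound (Filter.Eventually.of_forall fun x => ?_)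
  rw [enorm_eq_self]
  refine iSup_le fun c => iSup_le fun r => iSup_le fun hr => iSup_le fun _ => ?_
  rw [one_div, ENNReal.rpow_inv_le_iff hq, mul_comm, ← div_eq_mul_inv,
    ENNReal.div_le_iff (gauss_ball_pos c hr).ne' (gauss_ball_lt_top c r).ne]
  exact h c r hr

/-- The factor by which an admissible ball has to be enlarged to carry the cones of lower height
with vertex in it. -/
def enlargement (β : ℝ) : ℝ := 1 + 2 * (2 * (1 + 2 * β))

/-- Two admissible balls that meet have centres at distance at most `2 * β`, so
`cutoff_le_of_dist_le` compares the cutoff terms; the heights compare the linear terms. -/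
lemma rad_le_mul_rad (hα : 0 < α) (hβ : 0 < β) {z w : E n × ℝ} (hz : 0 < z.2) (hw : w.2 ≤ z.2)
    {x : E n} (hxz : x ∈ Metric.ball z.1 (rad α β z.1 z.2))
    (hxw : x ∈ Metric.ball w.1 (rad α β w.1 w.2)) :
    rad α β w.1 w.2 ≤ 2 * (1 + 2 * β) * rad α β z.1 z.2 := by
  have hd : dist z.1 w.1 ≤ 2 * β := by
    have h1 := dist_triangle z.1 x w.1
    have h2 := rad_le α hβ z.1 z.2
    have h3 := rad_le α hβ w.1 w.2
    rw [Metric.mem_ball] at hxz hxw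
    rw [dist_comm z.1 x] at h1
    linarith
  have hc := cutoff_le_of_dist_le (by positivity) hd
  have hp : 0 ≤ α * z.2 := by positivity
  unfold rad
  rw [mul_min_of_nonneg _ _ (by positivity)]
  refine min_le_min ?_ ?_
  · nlinarith [mul_nonneg hβ.le hp, mul_le_mul_of_nonneg_left hw hα.le]
  · calc β * cutoff w.1 ≤ β * (2 * (1 + 2 * β) * cutoff z.1) := by gcongr
      _ = _ := by ring

/-- A vertex `y` of a cone through `w` is reached from the centre of the ball of `z` by way of `x`
and `w.1`. This crosses one radius of `z` and two radii of `w`, which is the shape `1 + 2 * (...)`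
of `enlargement`. -/
lemma mem_tent_enlargement (hα : 0 < α) (hβ : 0 < β) {z w : E n × ℝ} (hz : 0 < z.2)
    (hw0 : 0 < w.2) (hw : w.2 ≤ z.2) {x : E n} (hxz : x ∈ Metric.ball z.1 (rad α β z.1 z.2))
    (hxw : x ∈ Metric.ball w.1 (rad α β w.1 w.2)) :
    w ∈ tent α β (Metric.ball z.1 (enlargement β * rad α β z.1 z.2)) := by
  refine ⟨hw0, ?_⟩
  simp only [mem_iUnion, not_exists, cone, mem_ofPred_eq, not_and, not_lt, mem_compl_iff,
    Metric.mem_ball]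
  intro y hy _
  have hr := rad_le_mul_rad hα hβ hz hw hxz hxw
  rw [Metric.mem_ball] at hxz hxw
  have h1 := dist_triangle4 y w.1 x z.1
  rw [dist_comm y w.1, dist_comm w.1 x] at h1
  unfold enlargement at hy
  linarith

/-- The total mass of the truncated cone integrals over an admissible ball is controlled by
Carleson's condition on an enlarged ball. -/
lemma exists_setLIntegral_truncated_le (n : ℕ) (hα : 0 < α) (hβ : 0 < β) :
    ∃ D : ℝ≥0∞, D ≠ ∞ ∧ ∀ {q : ℝ}, 0 < q → ∀ {g : E n × ℝ → ℝ}, Measurable g →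
      ∀ z : E n × ℝ, 0 < z.2 →
        ∫⁻ x in Metric.ball z.1 (rad α β z.1 z.2),
          coneIntegral α β ({w | w.2 ≤ z.2}.indicator fun w => ‖g w‖ₑ ^ q) x ∂(gauss n) ≤
            D * tentENorm ∞ q α β g ^ q * ballMass α β z := by
  obtain ⟨D, hD, hdoub⟩ := exists_gauss_doubling n hβ.le
    (show 1 ≤ enlargement β by unfold enlargement; linarith)
  refine ⟨D, hD, fun {q} hq {g} hg z hz => ?_⟩
  set B := Metric.ball z.1 (rad α β z.1 z.2) 
  set T := tent α β (Metric.ball z.1 (enlargement β * rad α β z.1 z.2))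
  have hm : MeasurableSet {w : E n × ℝ | w.2 ≤ z.2} :=
    measurableSet_le measurable_snd measurable_const
  have hF : Measurable fun w => ‖g w‖ₑ ^ q := hg.enorm.pow_const q
  -- Duality moves the integral over `B` to the half-space, against the average of the indicator of
  -- `B`. That average is at most 1 and vanishes at points of lower height outside the enlarged tent
  -- `T`, because their balls miss `B`.
  have h1 := lintegral_coneIntegral_mul (α := α) (β := β) (hF.indicator hm)
    (h := B.indicator fun _ => 1) (measurable_const.indicator measurableSet_ball)
  have h2 : ∫⁻ x in B, coneIntegral α β ({w | w.2 ≤ z.2}.indicator fun w => ‖g w‖ₑ ^ q) x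
      ∂(gauss n) = ∫⁻ x, coneIntegral α β ({w | w.2 ≤ z.2}.indicator fun w => ‖g w‖ₑ ^ q) x *
        B.indicator (fun _ => 1) x ∂(gauss n) := by
    rw [← lintegral_indicator measurableSet_ball]
    refine lintegral_congr fun x => ?_
    by_cases hx : x ∈ B
    · rw [indicator_of_mem hx, indicator_of_mem hx, mul_one]
    · rw [indicator_of_notMem hx, indicator_of_notMem hx, mul_zero]
  rw [h2, h1]
  have hE0 : 0 < enlargement β * rad α β z.1 z.2 :=
    mul_pos (by unfold enlargement; positivity) (rad_pos hα hβ _ hz)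
  calc _ ≤ ∫⁻ w, T.indicator (fun w => ‖g w‖ₑ ^ q) w ∂(halfMeasure n) := by
        refine lintegral_mono_ae ?_
        filter_upwards [ae_pos] with w hw0
        by_cases hw : w.2 ≤ z.2
        · rw [indicator_of_mem (show w ∈ {w : E n × ℝ | w.2 ≤ z.2} from hw)]
          by_cases hwT : w ∈ T
          · rw [indicator_of_mem hwT]
            refine mul_le_of_le_one_right (zero_le) (ballAverage_le_of_le (fun x => ?_) w)
            exact indicator_le_self' (fun _ _ => zero_le) x
          · have : ballAverage α β (B.indicator fun _ => 1) w = 0 := by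
              unfold ballAverage
              rw [setLIntegral_congr_fun (g := fun _ => 0) measurableSet_ball, lintegral_zero,
                mul_zero]
              intro x hx
              refine indicator_of_notMem (fun hxB => hwT ?_) _
              exact mem_tent_enlargement hα hβ hz hw0 hw hxB hx
            simp [this]
        · rw [indicator_of_notMem (show w ∉ {w : E n × ℝ | w.2 ≤ z.2} from hw), zero_mul]
          exact zero_le
    _ = ∫⁻ w in T, ‖g w‖ₑ ^ q ∂(halfMeasure n) := lintegral_indicator (measurableSet_tent _) _
    _ ≤ tentENorm ∞ q α β g ^ q *
          gauss n (Metric.ball z.1 (enlargement β * rad α β z.1 z.2)) :=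
        setLIntegral_tent_le hα hβ hq g _ hE0
    _ ≤ tentENorm ∞ q α β g ^ q * (D * ballMass α β z) := by
        gcongr
        exact hdoub _ _ (min_le_right _ _)
    _ = _ := by ring

/-- The set is an initial segment of the line. Either it has a greatest element and lies in one
admissible half-line, or it is exhausted by the half-lines ending at its rational points, and
continuity from below applies. This replaces a stopping height, whose own half-line might exceed
`κ`. -/
lemma measure_setOf_measure_Iic_le (m : Measure ℝ) (κ : ℝ≥0∞) : m {t | m (Iic t) ≤ κ} ≤ κ := by
  set I := {t | m (Iic t) ≤ κ}
  have hdown : ∀ s t, s ≤ t → t ∈ I → s ∈ I := fun s t hst ht =>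
    (measure_mono (Iic_subset_Iic.2 hst)).trans ht
  by_cases hmax : ∃ b ∈ I, ∀ t ∈ I, t ≤ b
  · obtain ⟨b, hb, hbI⟩ := hmax
    exact (measure_mono fun t ht => hbI t ht).trans hb
  · push Not at hmax
    have hI : I ⊆ ⋃ k : {k : ℚ // (k : ℝ) ∈ I}, Iic ((k : ℚ) : ℝ) := fun t ht => by
      obtain ⟨s, hs, hts⟩ := hmax t ht
      obtain ⟨k, htk, hks⟩ := exists_rat_btwn hts
      exact mem_iUnion.2 ⟨⟨k, hdown _ _ hks.le hs⟩, htk.le⟩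
    refine (measure_mono hI).trans ?_
    rw [Directed.measure_iUnion]
    · exact iSup_le fun k => k.2
    · refine Monotone.directed_le fun k l hkl => Iic_subset_Iic.2 ?_
      exact_mod_cast hkl

/-- The part of a cone integral below the heights at which the truncated cone integral does not
exceed a threshold does not exceed the threshold either. -/
lemma setLIntegral_cone_truncated_le (F : E n × ℝ → ℝ≥0∞) (κ : ℝ≥0∞)
    (x : E n) :
    ∫⁻ z in cone α β x ∩ {z | coneIntegral α β ({w | w.2 ≤ z.2}.indicator F) x ≤ κ},
      F z / ballMass α β z ∂(halfMeasure n) ≤ κ := by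
  -- The weighted measure on the cone, projected to heights: its distribution function is the
  -- truncated cone integral.
  set m : Measure ℝ := (((halfMeasure n).restrict (cone α β x)).withDensity
    fun z => F z / ballMass α β z).map Prod.snd
  have hm : ∀ t, m (Iic t) = coneIntegral α β ({w | w.2 ≤ t}.indicator F) x := fun t => by
    have ht : MeasurableSet {w : E n × ℝ | w.2 ≤ t} :=
      measurableSet_le measurable_snd measurable_const
    rw [Measure.map_apply measurable_snd measurableSet_Iic,
      withDensity_apply _ (measurable_snd measurableSet_Iic)]
    unfold coneIntegral
    change ∫⁻ z in {w : E n × ℝ | w.2 ≤ t}, _ ∂_ = _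
    rw [← lintegral_indicator ht]
    refine lintegral_congr fun z => ?_
    by_cases hz : z ∈ {w : E n × ℝ | w.2 ≤ t}
    · simp only [indicator_of_mem hz]
    · simp only [indicator_of_notMem hz, ENNReal.zero_div]
  have hI : MeasurableSet {t | m (Iic t) ≤ κ} := by
    refine OrdConnected.measurableSet ⟨fun s _ t ht u hu => ?_⟩
    exact (measure_mono (Iic_subset_Iic.2 hu.2)).trans ht
  have h := measure_setOf_measure_Iic_le m κ
  rw [Measure.map_apply measurable_snd hI, withDensity_apply _ (measurable_snd hI),
    Measure.restrict_restrict (measurable_snd hI), inter_comm] at h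
  simp only [hm] at h
  exact h

lemma measurable_truncated {F : E n × ℝ → ℝ≥0∞} (hF : Measurable F) :
    Measurable fun v : E n × (E n × ℝ) =>
      coneIntegral α β ({w | w.2 ≤ v.2.2}.indicator F) v.1 := by
  unfold coneIntegral
  simp_rw [← lintegral_indicator (measurableSet_cone α β _)]
  have hs : MeasurableSet {v : (E n × (E n × ℝ)) × (E n × ℝ) |
      v.2 ∈ cone α β v.1.1 ∧ v.2.2 ≤ v.1.2.2} := by
    refine MeasurableSet.inter ?_ (measurableSet_le (measurable_snd.comp measurable_snd)
      (measurable_snd.comp (measurable_snd.comp measurable_fst)))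
    exact (measurableSet_cone' (n := n) α β).preimage
      ((measurable_fst.comp measurable_fst).prodMk measurable_snd)
  have := (((hF.div (measurable_ballMass (α := α) (β := β))).comp
    (measurable_snd (α := E n × (E n × ℝ)))).indicator hs).lintegral_prod_right'
      (ν := halfMeasure n)
  convert this using 3 with v
  funext z
  by_cases h1 : z ∈ cone α β v.1 <;> by_cases h2 : z.2 ≤ v.2.2 <;> simp [indicator, h1, h2]

/-- The pairing is bounded at the endpoint, by Carleson's duality argument. -/
lemma exists_lintegral_enorm_mul_le_top (n : ℕ) (hα : 0 < α) (hβ : 0 < β) {q q' : ℝ}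
    (hq : q.HolderConjugate q') :
    ∃ C : ℝ≥0∞, C ≠ ∞ ∧ ∀ {f g : E n × ℝ → ℝ}, Measurable f → Measurable g →
      tentENorm ∞ q' α β g ≠ ∞ → ∫⁻ z, ‖f z‖ₑ * ‖g z‖ₑ ∂(halfMeasure n) ≤
        C * (tentENorm 1 q α β f * tentENorm ∞ q' α β g) := by
  obtain ⟨D, hD, htrunc⟩ := exists_setLIntegral_truncated_le n hα hβ
  have hq0 := hq.symm.pos
  refine ⟨2 * (2 * (D + 1)) ^ (1 / q'), ENNReal.mul_ne_top (by simp)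
    (ENNReal.rpow_ne_top_of_nonneg hq.symm.one_div_nonneg
      (ENNReal.mul_ne_top (by simp) (by simpa using hD))), fun {f g} hf hg hN => ?_⟩
  set N := tentENorm ∞ q' α β g with hNdef
  rcases eq_or_ne N 0 with hN0 | hN0
  · have hg0 : g =ᵐ[halfMeasure n] 0 := by
      refine ae_eq_zero_of_carlesonFun hq.symm.lt.le hα hβ hg ?_
      rw [← tentENorm_top, ← hNdef, hN0]
    refine le_of_eq_of_le (lintegral_eq_zero_of_ae_eq_zero ?_) (zero_le)
    filter_upwards [hg0] with z hz
    simp [hz]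
  set F : E n × ℝ → ℝ≥0∞ := fun z => ‖g z‖ₑ ^ q'
  have hF : Measurable F := hg.enorm.pow_const q'
  -- The threshold at which Chebyshev leaves at most half of each admissible ball in the bad set.
  -- Using `D + 1` in place of `D` keeps it nonzero, as does the separate treatment of `N = 0`.
  set κ := 2 * (D + 1) * N ^ q' with hκ
  have hNq : N ^ q' ≠ 0 := by simp [hN0, hN]
  have hNq' : N ^ q' ≠ ∞ := ENNReal.rpow_ne_top_of_nonneg hq0.le hN
  have hκ0 : κ ≠ 0 := mul_ne_zero (mul_ne_zero (by simp) (by simp)) hNq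
  have hκt : κ ≠ ∞ := ENNReal.mul_ne_top (ENNReal.mul_ne_top (by simp) (by simpa using hD)) hNq'
  set V : E n × (E n × ℝ) → ℝ≥0∞ :=
    fun v => coneIntegral α β ({w | w.2 ≤ v.2.2}.indicator F) v.1
  have hV : Measurable V := measurable_truncated hF
  have hgood : MeasurableSet {v | V v ≤ κ} := measurableSet_le hV measurable_const
  -- The good vertices, those whose cone integral of `|g|^q'` truncated at the height of `z` is at
  -- most `κ`, fill at least half of the ball of `z`.
  have hhalf : ∀ z : E n × ℝ, 0 < z.2 → ballMass α β z ≤ 2 *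
      ∫⁻ x in Metric.ball z.1 (rad α β z.1 z.2), {v | V v ≤ κ}.indicator (fun _ => 1) (x, z)
        ∂(gauss n) := fun z hz => by
    set m := (gauss n).restrict (Metric.ball z.1 (rad α β z.1 z.2))
    have hVz : Measurable fun x => V (x, z) := hV.comp (measurable_id.prodMk measurable_const)
    have hA : MeasurableSet {x | V (x, z) ≤ κ} := measurableSet_le hVz measurable_const
    have hint : ∫⁻ x, {v | V v ≤ κ}.indicator (fun _ => 1) (x, z) ∂m = m {x | V (x, z) ≤ κ} := by
      rw [← lintegral_indicator_one hA]
      rfl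
    have hmass : ballMass α β z = m univ := by simp [m, ballMass]
    have hbad : m {x | κ ≤ V (x, z)} ≤ ballMass α β z / 2 := by
      have h1 := mul_meas_ge_le_lintegral (μ := m) hVz κ
      have h2 := h1.trans (htrunc hq0 hg z hz)
      have h3 : D * N ^ q' * ballMass α β z ≤ κ * (ballMass α β z / 2) := by
        calc _ ≤ (D + 1) * N ^ q' * ballMass α β z := by gcongr; exact le_self_add
          _ = (D + 1) * N ^ q' * (ballMass α β z / 2 * 2) := by
            rw [ENNReal.div_mul_cancel (by simp) (by simp)]
          _ = _ := by rw [hκ]; ring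
      exact (ENNReal.mul_le_mul_iff_right hκ0 hκt).1 (h2.trans h3)
    rw [hint]
    have hcov : ballMass α β z ≤ m {x | V (x, z) ≤ κ} + ballMass α β z / 2 := by
      calc ballMass α β z = m univ := hmass
        _ ≤ m ({x | V (x, z) ≤ κ} ∪ {x | κ ≤ V (x, z)}) :=
          measure_mono fun x _ => le_total (V (x, z)) κ
        _ ≤ m {x | V (x, z) ≤ κ} + m {x | κ ≤ V (x, z)} := measure_union_le _ _
        _ ≤ _ := by gcongr
    have hfin : ballMass α β z / 2 ≠ ∞ :=
      (ENNReal.div_lt_top (ballMass_ne_top z) (by simp)).ne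
    have h4 : ballMass α β z / 2 ≤ m {x | V (x, z) ≤ κ} := by
      nth_rewrite 1 [← ENNReal.add_halves (ballMass α β z)] at hcov
      exact (ENNReal.add_le_add_iff_right hfin).1 hcov
    rw [mul_comm, ← ENNReal.div_le_iff (by simp) (by simp)]
    exact h4
  have hH : Measurable fun z => ‖f z‖ₑ * ‖g z‖ₑ := hf.enorm.mul hg.enorm
  have hG : Measurable fun v : E n × (E n × ℝ) =>
      ‖f v.2‖ₑ * ‖g v.2‖ₑ * {v | V v ≤ κ}.indicator (fun _ => 1) v :=
    (hH.comp measurable_snd).mul (measurable_const.indicator hgood)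
  have hG1 : ∀ z, Measurable fun x => {v | V v ≤ κ}.indicator (fun _ => (1 : ℝ≥0∞)) (x, z) :=
    fun z => (measurable_const.indicator hgood).comp (measurable_id.prodMk measurable_const)
  have hκq : κ ^ (1 / q') = (2 * (D + 1)) ^ (1 / q') * N := by
    rw [hκ, ENNReal.mul_rpow_of_nonneg _ _ hq.symm.one_div_nonneg, ← ENNReal.rpow_mul,
      mul_one_div_cancel hq0.ne', ENNReal.rpow_one]
  -- The integrand is spread over the good vertices only, and Fubini turns this into cones
  -- restricted to good heights. There Hölder leaves the full area function of `f` and at most `κ ^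
  -- (1 / q')` from `g`.
  calc ∫⁻ z, ‖f z‖ₑ * ‖g z‖ₑ ∂(halfMeasure n)
      ≤ ∫⁻ z, 2 * ((ballMass α β z)⁻¹ * ∫⁻ x in Metric.ball z.1 (rad α β z.1 z.2),
          ‖f z‖ₑ * ‖g z‖ₑ * {v | V v ≤ κ}.indicator (fun _ => 1) (x, z) ∂(gauss n))
            ∂(halfMeasure n) := by
        refine lintegral_mono_ae ?_
        filter_upwards [ae_pos] with z hz
        rw [lintegral_const_mul _ (hG1 z)]
        calc ‖f z‖ₑ * ‖g z‖ₑ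
            = ‖f z‖ₑ * ‖g z‖ₑ * ((ballMass α β z)⁻¹ * ballMass α β z) := by
              rw [ENNReal.inv_mul_cancel (ballMass_ne_zero hα hβ hz) (ballMass_ne_top z), mul_one]
          _ ≤ ‖f z‖ₑ * ‖g z‖ₑ * ((ballMass α β z)⁻¹ * (2 *
              ∫⁻ x in Metric.ball z.1 (rad α β z.1 z.2),
                {v | V v ≤ κ}.indicator (fun _ => 1) (x, z) ∂(gauss n))) := by
              gcongr; exact hhalf z hz
          _ = _ := by ring
    _ = 2 * ∫⁻ x, ∫⁻ z in cone α β x, ‖f z‖ₑ * ‖g z‖ₑ *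
          {v | V v ≤ κ}.indicator (fun _ => 1) (x, z) / ballMass α β z
            ∂(halfMeasure n) ∂(gauss n) := by
        rw [lintegral_const_mul, lintegral_cone_swap hG]
        exact measurable_ballMass.inv.mul (measurable_setLIntegral_ball hG)
    _ ≤ 2 * ∫⁻ x, areaFun q α β f x * κ ^ (1 / q') ∂(gauss n) := by
        gcongr with x
        have hgx : MeasurableSet {z | V (x, z) ≤ κ} :=
          measurableSet_le (hV.comp (measurable_const.prodMk measurable_id)) measurable_const
        calc _ = ∫⁻ z in cone α β x ∩ {z | V (x, z) ≤ κ},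
              ‖f z‖ₑ * ‖g z‖ₑ / ballMass α β z ∂(halfMeasure n) := by
              rw [inter_comm, ← Measure.restrict_restrict hgx, ← lintegral_indicator hgx]
              refine lintegral_congr fun z => ?_
              by_cases hz : V (x, z) ≤ κ <;> simp [indicator, hz]
          _ ≤ _ := setLIntegral_weighted_holder hq hf hg _
          _ ≤ areaFun q α β f x * κ ^ (1 / q') := by
              refine mul_le_mul' ?_ ?_
              · rw [areaFun_eq]
                refine ENNReal.rpow_le_rpow ?_ hq.one_div_nonneg
                exact lintegral_mono_set inter_subset_left
              · refine ENNReal.rpow_le_rpow ?_ hq.symm.one_div_nonneg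
                exact setLIntegral_cone_truncated_le F κ x
    _ = 2 * (κ ^ (1 / q') * tentENorm 1 q α β f) := by
        rw [lintegral_mul_const _ (measurable_areaFun q α β hf),
          tentENorm_of_ne_top one_ne_zero ENNReal.one_ne_top]
        simp [mul_comm]
    _ = _ := by rw [hκq]; ring

/-- The duality pairing is bounded. -/
lemma exists_lintegral_enorm_mul_le (n : ℕ) (hα : 0 < α) (hβ : 0 < β) {p p' : ℝ≥0∞} (hp : p ≠ ∞)
    (hpp' : p.HolderConjugate p') {q q' : ℝ} (hq : q.HolderConjugate q') :
    ∃ C : ℝ≥0∞, C ≠ ∞ ∧ ∀ {f g : E n × ℝ → ℝ}, Measurable f → Measurable g →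
      tentENorm p' q' α β g ≠ ∞ → ∫⁻ z, ‖f z‖ₑ * ‖g z‖ₑ ∂(halfMeasure n) ≤
        C * (tentENorm p q α β f * tentENorm p' q' α β g) := by
  by_cases hp' : p' = ∞
  · have hsymm : p'.HolderConjugate p := hpp'.symm
    obtain rfl : p = 1 := (ENNReal.HolderConjugate.eq_top_iff_eq_one p' p).1 hp'
    subst hp'
    exact exists_lintegral_enorm_mul_le_top n hα hβ hq
  · refine ⟨1, ENNReal.one_ne_top, fun {f g} hf hg _ => ?_⟩
    rw [one_mul]
    exact lintegral_enorm_mul_le_of_ne_top hα hβ hp hp' hpp' hq hf hg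

end pairing

section density

open Filter Topology

/-! ### Densities of functionals on bounded functions -/

/-- A linear functional on the bounded measurable functions on a finite measure space that is
continuous for an `L^q` norm is integration against an integrable function. -/
lemma exists_density_of_le_lintegral_rpow {X : Type*} [MeasurableSpace X] {ρ : Measure X}
    [IsFiniteMeasure ρ] (Λ : (X → ℝ) → ℝ) {q : ℝ} (hq : 0 < q) {C : ℝ≥0∞} (hC : C ≠ ∞)
    (hadd : ∀ b b' : X → ℝ, Measurable b → Measurable b' → (∃ k, ∀ x, ‖b x‖ ≤ k) →
      (∃ k, ∀ x, ‖b' x‖ ≤ k) → Λ (fun x => b x + b' x) = Λ b + Λ b')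
    (hsmul : ∀ (c : ℝ) (b : X → ℝ), Measurable b → (∃ k, ∀ x, ‖b x‖ ≤ k) →
      Λ (fun x => c * b x) = c * Λ b)
    (hbound : ∀ b : X → ℝ, Measurable b → (∃ k, ∀ x, ‖b x‖ ≤ k) →
      ‖Λ b‖ₑ ≤ C * (∫⁻ x, ‖b x‖ₑ ^ q ∂ρ) ^ (1 / q)) :
    ∃ g : X → ℝ, Measurable g ∧ Integrable g ρ ∧ ∀ b : X → ℝ, Measurable b →
      (∃ k, ∀ x, ‖b x‖ ≤ k) → Λ b = ∫ x, b x * g x ∂ρ := by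
  classical
  have hq1 : 0 < 1 / q := by positivity
  have hIm : ∀ {A : Set X}, MeasurableSet A → Measurable (A.indicator fun _ => (1 : ℝ)) :=
    fun hA => measurable_const.indicator hA
  have hIb : ∀ A : Set X, ∃ k, ∀ x, ‖A.indicator (fun _ => (1 : ℝ)) x‖ ≤ k := fun A =>
    ⟨1, fun x => (norm_indicator_le_norm_self _ x).trans (by simp)⟩
  have hΛ0 : Λ (fun _ => 0) = 0 := by
    have := hsmul 0 (fun _ => 0) measurable_const ⟨0, by simp⟩
    simpa using this
  have hle : ∀ {A : Set X}, MeasurableSet A →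
      ‖Λ (A.indicator fun _ => 1)‖ₑ ≤ C * ρ A ^ (1 / q) := fun {A} hA => by
    refine (hbound _ (hIm hA) (hIb A)).trans_eq ?_
    rw [← lintegral_indicator_one hA]
    congr 3 with x
    by_cases hx : x ∈ A <;> simp [hx, hq]
  have hunion : ∀ {A B : Set X}, MeasurableSet A → MeasurableSet B → Disjoint A B →
      Λ ((A ∪ B).indicator fun _ => 1) =
        Λ (A.indicator fun _ => 1) + Λ (B.indicator fun _ => 1) := fun {A B} hA hB hAB => by
    rw [← hadd _ _ (hIm hA) (hIm hB) (hIb A) (hIb B), indicator_union_of_disjoint hAB]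
  -- The set function given by `Λ` on indicators is countably additive: the tail of a disjoint union
  -- has small `ρ`-measure, hence small image by `hle`. The same bound gives absolute continuity, so
  -- Radon–Nikodym applies.
  let ν : VectorMeasure X ℝ :=
    { measureOf' := fun A => if MeasurableSet A then Λ (A.indicator fun _ => 1) else 0
      empty' := by simpa using hΛ0
      not_measurable' := fun A hA => if_neg hA
      m_iUnion' := fun f hf hd => by
        have hfin : ∀ s : Finset ℕ, Λ ((⋃ i ∈ s, f i).indicator fun _ => 1) =
            ∑ i ∈ s, Λ ((f i).indicator fun _ => 1) := fun s => by
          induction s using Finset.induction_on with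
          | empty => simpa using hΛ0
          | insert a s ha ih =>
            rw [Finset.sum_insert ha, Finset.set_biUnion_insert, hunion (hf a)
              (s.measurableSet_biUnion fun i _ => hf i), ih]
            refine disjoint_iUnion₂_right.2 fun i hi => hd ?_
            rintro rfl
            exact ha hi
        have hsplit : ∀ s : Finset ℕ, Λ ((⋃ i, f i).indicator fun _ => 1) =
            ∑ i ∈ s, Λ ((f i).indicator fun _ => 1) +
              Λ ((⋃ i : {i // i ∉ s}, f i).indicator fun _ => 1) := fun s => by
          rw [← hfin, ← hunion (s.measurableSet_biUnion fun i _ => hf i)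
            (MeasurableSet.iUnion fun i : {i // i ∉ s} => hf i)]
          · congr 2
            ext x
            simp only [mem_iUnion, mem_union, exists_prop, Subtype.exists]
            exact ⟨fun ⟨i, hi⟩ => (em (i ∈ s)).imp (fun h => ⟨i, h, hi⟩) fun h => ⟨i, h, hi⟩,
              fun h => h.elim (fun ⟨i, _, hi⟩ => ⟨i, hi⟩) fun ⟨i, _, hi⟩ => ⟨i, hi⟩⟩
          · refine disjoint_iUnion₂_left.2 fun i hi => disjoint_iUnion_right.2 fun j => hd ?_
            rintro rfl
            exact j.2 hi
        simp only [hf, MeasurableSet.iUnion hf, if_true]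
        have htail : Tendsto (fun s : Finset ℕ => C * (∑' i : {i // i ∉ s}, ρ (f i)) ^ (1 / q))
            atTop (𝓝 0) := by
          have h0 := ENNReal.tendsto_tsum_compl_atTop_zero (f := fun i => ρ (f i)) (by
            rw [← measure_iUnion hd hf]; exact measure_ne_top _ _)
          have h1 := (ENNReal.continuous_rpow_const (y := 1 / q)).continuousAt.tendsto.comp h0
          rw [ENNReal.zero_rpow_of_pos hq1] at h1
          simpa using ENNReal.Tendsto.const_mul h1 (.inr hC)
        rw [HasSum, SummationFilter.unconditional_filter, tendsto_iff_edist_tendsto_0]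
        refine tendsto_of_tendsto_of_tendsto_of_le_of_le tendsto_const_nhds htail
          (fun _ => zero_le) fun s => ?_
        rw [edist_comm, edist_eq_enorm_sub, hsplit s, add_sub_cancel_left]
        refine (hle (MeasurableSet.iUnion fun i : {i // i ∉ s} => hf i)).trans ?_
        gcongr
        exact measure_iUnion_le _ }
  have hν : ∀ {A : Set X}, MeasurableSet A → ν A = Λ (A.indicator fun _ => 1) := fun hA => if_pos hA
  have hac : ν ≪ᵥ ρ.toENNRealVectorMeasure := by
    refine VectorMeasure.AbsolutelyContinuous.mk fun A hA h0 => ?_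
    rw [Measure.toENNRealVectorMeasure_apply_measurable hA] at h0
    have := hle hA
    rw [h0, ENNReal.zero_rpow_of_pos hq1, mul_zero] at this
    rw [hν hA]
    simpa using this
  set g := SignedMeasure.rnDeriv ν ρ
  have hgi : Integrable g ρ := SignedMeasure.integrable_rnDeriv ν ρ
  have hgA : ∀ {A : Set X}, MeasurableSet A → Λ (A.indicator fun _ => 1) = ∫ x in A, g x ∂ρ :=
    fun {A} hA => by
      rw [← hν hA, ← withDensityᵥ_apply hgi hA, SignedMeasure.withDensityᵥ_rnDeriv_eq ν ρ hac]
  refine ⟨g, SignedMeasure.measurable_rnDeriv ν ρ, hgi, ?_⟩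
  have hbdd : ∀ s : SimpleFunc X ℝ, ∃ k, ∀ x, ‖s x‖ ≤ k := fun s => s.exists_forall_norm_le
  have hgmul : ∀ {b : X → ℝ}, Measurable b → (∃ k, ∀ x, ‖b x‖ ≤ k) →
      Integrable (fun x => b x * g x) ρ := fun {b} hb ⟨k, hk⟩ =>
    hgi.bdd_mul hb.aestronglyMeasurable (Eventually.of_forall hk)
  have hsimple : ∀ s : SimpleFunc X ℝ, Λ s = ∫ x, s x * g x ∂ρ := fun s => by
    induction s using SimpleFunc.induction with
    | const c hA =>
      rename_i A
      have h1 : (⇑(SimpleFunc.piecewise A hA (SimpleFunc.const X c) (SimpleFunc.const X 0)) :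
          X → ℝ) = fun x => c * A.indicator (fun _ => 1) x := by
        ext x
        by_cases hx : x ∈ A <;> simp [hx]
      rw [h1, hsmul c _ (hIm hA) (hIb A), hgA hA, ← integral_indicator hA, ← integral_const_mul]
      refine integral_congr_ae (Eventually.of_forall fun x => ?_)
      by_cases hx : x ∈ A <;> simp [hx]
    | add _ hs ht =>
      rename_i s t _
      have h1 : (⇑(s + t) : X → ℝ) = fun x => s x + t x := rfl
      rw [h1, hadd _ _ s.measurable t.measurable (hbdd s) (hbdd t), hs, ht,
        ← integral_add (hgmul s.measurable (hbdd s)) (hgmul t.measurable (hbdd t))]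
      simp only [add_mul]
  intro b hb ⟨k, hk⟩
  -- On an empty space the bound `k` might be negative.
  rcases isEmpty_or_nonempty X with hX | hX
  · have h1 : b = fun _ => 0 := funext fun x => hX.elim x
    rw [h1, hΛ0]
    simp
  have hk0 : 0 ≤ k := (norm_nonneg _).trans (hk (Classical.arbitrary X))
  -- Uniformly bounded simple functions converging pointwise: the integrals converge by domination
  -- by `k * ‖g x‖`, the values of `Λ` by the `L^q` bound on a finite measure.
  set s := hb.stronglyMeasurable.approxBounded k
  have hs1 : ∀ x, Tendsto (fun m => s m x) atTop (𝓝 (b x)) := fun x =>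
    hb.stronglyMeasurable.tendsto_approxBounded_of_norm_le (hk x)
  have hs2 : ∀ m x, ‖s m x‖ ≤ k := fun m x =>
    hb.stronglyMeasurable.norm_approxBounded_le hk0 m x
  have hlim1 : Tendsto (fun m => ∫ x, s m x * g x ∂ρ) atTop (𝓝 (∫ x, b x * g x ∂ρ)) := by
    refine tendsto_integral_of_dominated_convergence (fun x => k * ‖g x‖)
      (fun m => (hgmul (s m).measurable ⟨k, hs2 m⟩).aestronglyMeasurable) (hgi.norm.const_mul k)
      (fun m => Eventually.of_forall fun x => ?_)
      (Eventually.of_forall fun x => (hs1 x).mul_const _)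
    rw [norm_mul]
    gcongr
    exact hs2 m x
  have hlim2 : Tendsto (fun m => Λ (s m)) atTop (𝓝 (Λ b)) := by
    have hdiff : ∀ m, ‖Λ b - Λ (s m)‖ₑ ≤ C * (∫⁻ x, ‖b x + -1 * s m x‖ₑ ^ q ∂ρ) ^ (1 / q) :=
      fun m => by
        have hm1 : Measurable fun x => -1 * s m x := (s m).measurable.const_mul _
        have hm2 : ∀ x, ‖-1 * s m x‖ ≤ k := fun x => by simpa using hs2 m x
        have h1 := hadd b (fun x => -1 * s m x) hb hm1 ⟨k, hk⟩ ⟨k, hm2⟩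
        rw [hsmul _ _ (s m).measurable ⟨k, hs2 m⟩] at h1
        rw [show Λ b - Λ (s m) = Λ b + -1 * Λ (s m) by ring, ← h1]
        exact hbound _ (hb.add hm1) ⟨k + k, fun x => (norm_add_le _ _).trans
          (add_le_add (hk x) (hm2 x))⟩
    have hL : Tendsto (fun m => ∫⁻ x, ‖b x + -1 * s m x‖ₑ ^ q ∂ρ) atTop (𝓝 0) := by
      have := tendsto_lintegral_of_dominated_convergence (μ := ρ)
        (F := fun m x => ‖b x + -1 * s m x‖ₑ ^ q) (f := fun _ => 0)
        (fun _ => ENNReal.ofReal (k + k) ^ q)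
        (fun m => ((hb.add ((s m).measurable.const_mul _)).enorm.pow_const q))
        (fun m => Eventually.of_forall fun x => ?_) ?_ (Eventually.of_forall fun x => ?_)
      · simpa using this
      · dsimp only
        gcongr
        rw [← ofReal_norm]
        refine ENNReal.ofReal_le_ofReal ((norm_add_le _ _).trans (add_le_add (hk x) ?_))
        simpa using hs2 m x
      · rw [lintegral_const]
        exact ENNReal.mul_ne_top (ENNReal.rpow_ne_top_of_nonneg hq.le ENNReal.ofReal_ne_top)
          (measure_ne_top _ _)
      · have h1 : Tendsto (fun m => ‖b x + -1 * s m x‖ₑ) atTop (𝓝 0) := by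
          have h2 : Tendsto (fun m => b x + -1 * s m x) atTop (𝓝 (b x + -1 * b x)) :=
            ((hs1 x).const_mul _).const_add _
          simpa using h2.enorm
        have h3 := (ENNReal.continuous_rpow_const (y := q)).continuousAt.tendsto.comp h1
        rw [ENNReal.zero_rpow_of_pos hq] at h3
        exact h3
    have hR : Tendsto (fun m => C * (∫⁻ x, ‖b x + -1 * s m x‖ₑ ^ q ∂ρ) ^ (1 / q)) atTop
        (𝓝 0) := by
      have h1 := (ENNReal.continuous_rpow_const (y := 1 / q)).continuousAt.tendsto.comp hL
      rw [ENNReal.zero_rpow_of_pos hq1] at h1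
      simpa using ENNReal.Tendsto.const_mul h1 (.inr hC)
    rw [tendsto_iff_edist_tendsto_0]
    refine tendsto_of_tendsto_of_tendsto_of_le_of_le tendsto_const_nhds hR
      (fun _ => zero_le) fun m => ?_
    rw [edist_comm, edist_eq_enorm_sub]
    exact hdiff m
  refine tendsto_nhds_unique hlim2 (hlim1.congr fun m => (hsimple (s m)).symm)

end density

/-! ### Truncation, the Fatou property, and weights lying in the tent spaces. -/

section truncation

open Filter Topology

variable {n : ℕ} {α β : ℝ}

/-! ### Truncations in the tent spaces -/

lemma areaFun_mono {q : ℝ} (hq : 0 < q) {f g : E n × ℝ → ℝ} (h : ∀ z, ‖f z‖ₑ ≤ ‖g z‖ₑ) (x : E n) :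
    areaFun q α β f x ≤ areaFun q α β g x := by
  unfold areaFun
  gcongr with z
  exact h z

lemma tentENorm_mono (p : ℝ≥0∞) {q : ℝ} (hq : 0 < q) {f g : E n × ℝ → ℝ}
    (h : ∀ z, ‖f z‖ₑ ≤ ‖g z‖ₑ) : tentENorm p q α β f ≤ tentENorm p q α β g := by
  unfold tentENorm
  split_ifs
  · refine eLpNorm_mono_enorm fun x => ?_
    simp only [enorm_eq_self, carlesonFun]
    gcongr with c r hr hx z
    exact h z
  · refine eLpNorm_mono_enorm fun x => ?_
    simp only [enorm_eq_self]
    exact areaFun_mono hq h x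

lemma enorm_indicator_rpow {q : ℝ} (hq : 0 < q) (A : Set (E n × ℝ)) (f : E n × ℝ → ℝ)
    (z : E n × ℝ) : ‖A.indicator f z‖ₑ ^ q = A.indicator (fun z => ‖f z‖ₑ ^ q) z := by
  by_cases hz : z ∈ A <;> simp [hz, hq]

/-- Dominated convergence in the tent spaces with finite exponents. -/
lemma tendsto_tentENorm_indicator {p : ℝ≥0∞} (hp0 : p ≠ 0) (hp : p ≠ ∞) {q : ℝ} (hq : 0 < q)
    {f : E n × ℝ → ℝ} (hf : Measurable f) (hfin : tentENorm p q α β f ≠ ∞)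
    {A : ℕ → Set (E n × ℝ)} (hA : ∀ k, MeasurableSet (A k)) (hev : ∀ z, ∀ᶠ k in atTop, z ∉ A k) :
    Tendsto (fun k => tentENorm p q α β ((A k).indicator f)) atTop (𝓝 0) := by
  have hP : 0 < p.toReal := ENNReal.toReal_pos hp0 hp
  have hrpow : ∀ {r : ℝ} (_ : 0 < r) {u : ℕ → ℝ≥0∞}, Tendsto u atTop (𝓝 0) →
      Tendsto (fun k => u k ^ r) atTop (𝓝 0) := fun {r} hr u hu => by
    have := (ENNReal.continuous_rpow_const (y := r)).continuousAt.tendsto.comp hu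
    rwa [ENNReal.zero_rpow_of_pos hr] at this
  rw [tentENorm_of_ne_top hp0 hp] at hfin
  simp only [tentENorm_of_ne_top hp0 hp]
  refine hrpow (by positivity) ?_
  have hS : ∫⁻ x, areaFun q α β f x ^ p.toReal ∂(gauss n) ≠ ∞ := by
    rwa [Ne, ENNReal.rpow_eq_top_iff_of_pos (by positivity)] at hfin
  have hSm := (measurable_areaFun q α β hf).pow_const p.toReal
  have hpt : ∀ᵐ x ∂(gauss n), Tendsto
      (fun k => areaFun q α β ((A k).indicator f) x ^ p.toReal) atTop (𝓝 0) := by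
    -- Dominated convergence is used twice: inside the cone at each vertex with finite area
    -- function, then in the vertex.
    filter_upwards [ae_lt_top hSm hS] with x hx
    refine hrpow hP ?_
    have hV : coneIntegral α β (fun z => ‖f z‖ₑ ^ q) x ≠ ∞ := by
      rw [← areaFun_rpow hq]
      refine ENNReal.rpow_ne_top_of_nonneg hq.le fun h => ?_
      rw [h, ENNReal.top_rpow_of_pos hP] at hx
      exact lt_irrefl _ hx
    simp only [areaFun_eq]
    refine hrpow (by positivity) ?_
    have hzero : ∫⁻ _ in cone α β x, 0 ∂(halfMeasure n) = 0 := lintegral_zero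
    rw [← hzero]
    refine tendsto_lintegral_of_dominated_convergence (fun z => ‖f z‖ₑ ^ q / ballMass α β z)
      (fun k => measurable_integrand q α β (hf.indicator (hA k)))
      (fun k => Eventually.of_forall fun z => ?_) hV (Eventually.of_forall fun z => ?_)
    · dsimp only
      rw [enorm_indicator_rpow hq]
      gcongr
      exact indicator_le_self' (fun _ _ => zero_le) z
    · refine tendsto_const_nhds.congr' ?_
      filter_upwards [hev z] with k hk
      simp [hk, hq]
  have := tendsto_lintegral_of_dominated_convergence (fun x => areaFun q α β f x ^ p.toReal)
    (fun k => (measurable_areaFun q α β (hf.indicator (hA k))).pow_const p.toReal)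
    (fun k => Eventually.of_forall fun x => ?_) hS hpt
  · simpa using this
  · dsimp only
    gcongr
    exact areaFun_mono hq (fun z => enorm_indicator_le_enorm_self _ _) x

lemma tendsto_lintegral_indicator {X : Type*} [MeasurableSpace X] (ν : Measure X) {F : X → ℝ≥0∞}
    (hF : Measurable F) {A : ℕ → Set X} (hA : ∀ k, MeasurableSet (A k)) (hmono : Monotone A)
    (hev : ∀ x, ∃ k, x ∈ A k) :
    Tendsto (fun k => ∫⁻ x, (A k).indicator F x ∂ν) atTop (𝓝 (∫⁻ x, F x ∂ν)) := by
  refine lintegral_tendsto_of_tendsto_of_monotone (fun k => (hF.indicator (hA k)).aemeasurable)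
    (Eventually.of_forall fun x k l hkl => ?_) (Eventually.of_forall fun x => ?_)
  · exact indicator_le_indicator_of_subset (hmono hkl) (fun _ => zero_le) x
  · obtain ⟨k, hk⟩ := hev x
    refine tendsto_const_nhds.congr' ?_
    filter_upwards [eventually_ge_atTop k] with l hl
    rw [indicator_of_mem (hmono hl hk)]

/-- The tent space norms have the Fatou property. -/
lemma tentENorm_le_of_forall_indicator_le (hα : 0 < α) (hβ : 0 < β) {p : ℝ≥0∞} (hp0 : p ≠ 0) {q : ℝ} (hq : 0 < q)
    {g : E n × ℝ → ℝ} (hg : Measurable g) {A : ℕ → Set (E n × ℝ)}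
    (hA : ∀ k, MeasurableSet (A k)) (hmono : Monotone A) (hev : ∀ z, ∃ k, z ∈ A k) {L : ℝ≥0∞}
    (hL : ∀ k, tentENorm p q α β ((A k).indicator g) ≤ L) : tentENorm p q α β g ≤ L := by
  have hF : Measurable fun z => ‖g z‖ₑ ^ q := hg.enorm.pow_const q
  by_cases hp : p = ∞
  · subst hp
    refine tentENorm_top_le hq fun c r hr => ?_
    refine le_of_tendsto (tendsto_lintegral_indicator
      ((halfMeasure n).restrict (tent α β (Metric.ball c r))) hF hA hmono hev)
      (Eventually.of_forall fun k => ?_)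
    simp only [← enorm_indicator_rpow hq]
    refine (setLIntegral_tent_le hα hβ hq _ c hr).trans ?_
    gcongr
    exact hL k
  · have hP : 0 < p.toReal := ENNReal.toReal_pos hp0 hp
    simp only [tentENorm_of_ne_top hp0 hp] at hL ⊢
    have hpt : ∀ x, Tendsto (fun k => areaFun q α β ((A k).indicator g) x ^ p.toReal) atTop
        (𝓝 (areaFun q α β g x ^ p.toReal)) := fun x => by
      refine (ENNReal.continuous_rpow_const.tendsto _).comp ?_
      refine (ENNReal.continuous_rpow_const.tendsto _).comp ?_
      refine (tendsto_lintegral_indicator ((halfMeasure n).restrict (cone α β x))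
        (measurable_integrand q α β hg) hA hmono hev).congr fun k => lintegral_congr fun z => ?_
      rw [enorm_indicator_rpow hq]
      by_cases hz : z ∈ A k <;> simp [hz]
    have hmono2 : ∀ x, Monotone fun k => areaFun q α β ((A k).indicator g) x ^ p.toReal :=
      fun x k l hkl => by
        dsimp only
        gcongr
        refine areaFun_mono hq (fun z => ?_) x
        by_cases hz : z ∈ A k
        · simp [hz, hmono hkl hz]
        · simp [hz]
    have h1 := lintegral_tendsto_of_tendsto_of_monotone (μ := gauss n)
      (fun k => ((measurable_areaFun q α β (hg.indicator (hA k))).pow_const _).aemeasurable)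
      (Eventually.of_forall hmono2) (Eventually.of_forall hpt)
    exact le_of_tendsto ((ENNReal.continuous_rpow_const.tendsto _).comp h1)
      (Eventually.of_forall hL)

/-! ### Weights that generate the tent spaces -/

/-- A positive function that lies in all tent spaces with finite exponents, together with an
integrable density that shows this. -/
structure IsTentWeight (α β : ℝ) (φ : E n × ℝ → ℝ) (ψ : E n × ℝ → NNReal) : Prop where
  measurable : Measurable φ
  measurable_density : Measurable ψ
  pos : ∀ z, 0 < φ z
  le_one : ∀ z, φ z ≤ 1
  lintegral_density_ne_top : ∫⁻ z, ψ z ∂(halfMeasure n) ≠ ∞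
  lintegral_ne_top : ∫⁻ z, ‖φ z‖ₑ ∂(halfMeasure n) ≠ ∞
  enorm_le : ∀ z, 0 < z.2 → ‖φ z‖ₑ ≤ ψ z * ballMass α β z

/-- A σ-finite measure carries a positive integrable density `ψ`. Multiplying it by `ballMass`
cancels the normalization of the cone integral, and the minimum with 1 ensures that powers of `φ`
with exponent at least 1 are bounded by `φ`. -/
lemma exists_isTentWeight (n : ℕ) (hα : 0 < α) (hβ : 0 < β) :
    ∃ (φ : E n × ℝ → ℝ) (ψ : E n × ℝ → NNReal), IsTentWeight α β φ ψ := by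
  obtain ⟨ψ, hψ0, hψm, hψ⟩ :=
    exists_pos_lintegral_lt_of_sigmaFinite (halfMeasure n) (one_ne_zero (α := ℝ≥0∞))
  set u : E n × ℝ → ℝ≥0∞ := fun z => min 1 (ψ z * ballMass α β z) with hu
  have hum : Measurable u :=
    measurable_const.min (hψm.coe_nnreal_ennreal.mul measurable_ballMass)
  have hu1 : ∀ z, u z ≤ 1 := fun z => min_le_left _ _
  have hut : ∀ z, u z ≠ ∞ := fun z => ((hu1 z).trans_lt ENNReal.one_lt_top).ne
  have hs : MeasurableSet {z : E n × ℝ | 0 < z.2} := measurableSet_lt measurable_const measurable_snd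
  classical
  -- The value 1 off the half-space, a null set, keeps `φ` positive everywhere, so that one may
  -- divide by it.
  set φ : E n × ℝ → ℝ := fun z => if 0 < z.2 then (u z).toReal else 1 with hφ
  have hle : ∀ z, 0 < z.2 → ‖φ z‖ₑ ≤ ψ z * ballMass α β z := fun z hz => by
    simp only [hφ, if_pos hz]
    rw [Real.enorm_eq_ofReal ENNReal.toReal_nonneg, ENNReal.ofReal_toReal (hut z)]
    exact min_le_right _ _
  refine ⟨φ, ψ, ⟨Measurable.ite hs hum.ennreal_toReal measurable_const, hψm, fun z => ?_,
    fun z => ?_, (hψ.trans ENNReal.one_lt_top).ne, ?_, hle⟩⟩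
  · simp only [hφ]
    split_ifs with hz
    · refine ENNReal.toReal_pos (ne_of_gt ?_) (hut z)
      refine lt_min one_pos (ENNReal.mul_pos ?_ (ballMass_ne_zero hα hβ hz))
      exact_mod_cast (hψ0 z).ne'
    · exact one_pos
  · simp only [hφ]
    split_ifs
    · exact ENNReal.toReal_le_of_le_ofReal zero_le_one (by simpa using hu1 z)
    · exact le_rfl
  · refine ne_top_of_le_ne_top (ENNReal.mul_ne_top (hψ.trans ENNReal.one_lt_top).ne
      (measure_ne_top (gauss n) univ)) ?_
    calc ∫⁻ z, ‖φ z‖ₑ ∂(halfMeasure n)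
        ≤ ∫⁻ z, ψ z * gauss n univ ∂(halfMeasure n) := by
          refine lintegral_mono_ae ?_
          filter_upwards [ae_pos] with z hz
          refine (hle z hz).trans ?_
          gcongr
          exact measure_mono (subset_univ _)
      _ = _ := lintegral_mul_const _ hψm.coe_nnreal_ennreal

variable {φ : E n × ℝ → ℝ} {ψ : E n × ℝ → NNReal}

/-- On a cone `φ ^ q ≤ φ ≤ ψ * ballMass`, and the right-hand side no longer depends on the vertex.
-/
lemma IsTentWeight.coneIntegral_mul_le (hφ : IsTentWeight α β φ ψ) {q : ℝ} (hq : 1 ≤ q)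
    (b : E n × ℝ → ℝ) (x : E n) :
    coneIntegral α β (fun z => ‖b z * φ z‖ₑ ^ q) x ≤
      ∫⁻ z, ‖b z‖ₑ ^ q ∂((halfMeasure n).withDensity fun z => (ψ z : ℝ≥0∞)) := by
  have hq0 : 0 < q := by linarith
  rw [lintegral_withDensity_eq_lintegral_mul_non_measurable _
    hφ.measurable_density.coe_nnreal_ennreal (by simp)]
  unfold coneIntegral
  refine (setLIntegral_mono' (measurableSet_cone α β x) fun z hz => ?_).trans
    (setLIntegral_le_lintegral _ _)
  simp only [Pi.mul_apply]
  rw [enorm_mul, ENNReal.mul_rpow_of_nonneg _ _ hq0.le, mul_div_assoc, mul_comm]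
  gcongr
  refine ENNReal.div_le_of_le_mul ?_
  refine le_trans ?_ (hφ.enorm_le z hz.1)
  have h1 : ‖φ z‖ₑ ≤ 1 := by
    rw [Real.enorm_eq_ofReal (hφ.pos z).le]
    exact ENNReal.ofReal_le_one.2 (hφ.le_one z)
  simpa using ENNReal.rpow_le_rpow_of_exponent_ge h1 hq

/-- As the Gaussian measure is finite, the uniform bound shows that multiplication by `φ` maps `L^q`
of the density `ψ` boundedly into the tent space. Functionals can thus be pulled back to a finite
measure space. -/
lemma IsTentWeight.tentENorm_mul_le (hφ : IsTentWeight α β φ ψ) {p : ℝ≥0∞} (hp0 : p ≠ 0)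
    (hp : p ≠ ∞) {q : ℝ} (hq : 1 ≤ q) (b : E n × ℝ → ℝ) :
    tentENorm p q α β (fun z => b z * φ z) ≤ gauss n univ ^ (1 / p.toReal) *
      (∫⁻ z, ‖b z‖ₑ ^ q ∂((halfMeasure n).withDensity fun z => (ψ z : ℝ≥0∞))) ^ (1 / q) := by
  have hP : 0 < p.toReal := ENNReal.toReal_pos hp0 hp
  set I := ∫⁻ z, ‖b z‖ₑ ^ q ∂((halfMeasure n).withDensity fun z => (ψ z : ℝ≥0∞))
  rw [tentENorm_of_ne_top hp0 hp]
  calc _ ≤ (∫⁻ _, (I ^ (1 / q)) ^ p.toReal ∂(gauss n)) ^ (1 / p.toReal) := by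
        gcongr with x
        rw [areaFun_eq]
        gcongr
        exact hφ.coneIntegral_mul_le hq b x
    _ = _ := by
        rw [lintegral_const, ENNReal.mul_rpow_of_nonneg _ _ (by positivity),
          ← ENNReal.rpow_mul _ p.toReal, mul_one_div_cancel hP.ne', ENNReal.rpow_one, mul_comm]

lemma IsTentWeight.lintegral_rpow_ne_top (hφ : IsTentWeight α β φ ψ) {q : ℝ} (hq : 0 ≤ q)
    {b : E n × ℝ → ℝ} {k : ℝ} (hb : ∀ z, ‖b z‖ ≤ k) :
    ∫⁻ z, ‖b z‖ₑ ^ q ∂((halfMeasure n).withDensity fun z => (ψ z : ℝ≥0∞)) ≠ ∞ := by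
  refine ne_top_of_le_ne_top (ENNReal.mul_ne_top (ENNReal.rpow_ne_top_of_nonneg hq
    (ENNReal.ofReal_ne_top (r := k))) hφ.lintegral_density_ne_top) ?_
  calc _ ≤ ∫⁻ _, ENNReal.ofReal k ^ q ∂((halfMeasure n).withDensity fun z => (ψ z : ℝ≥0∞)) := by
        gcongr with z
        rw [← ofReal_norm]
        exact ENNReal.ofReal_le_ofReal (hb z)
    _ = _ := by rw [lintegral_const, withDensity_apply _ MeasurableSet.univ, setLIntegral_univ]

lemma IsTentWeight.norm_div_le (hφ : IsTentWeight α β φ ψ) {f : E n × ℝ → ℝ} {k : ℝ}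
    (hf : ∀ z, ‖f z‖ ≤ k * φ z) (z : E n × ℝ) : ‖f z / φ z‖ ≤ k := by
  rw [norm_div, Real.norm_of_nonneg (hφ.pos z).le, div_le_iff₀ (hφ.pos z)]
  exact hf z

lemma IsTentWeight.tentENorm_ne_top (hφ : IsTentWeight α β φ ψ) {p : ℝ≥0∞} (hp0 : p ≠ 0)
    (hp : p ≠ ∞) {q : ℝ} (hq : 1 ≤ q) {f : E n × ℝ → ℝ} {k : ℝ} (hf : ∀ z, ‖f z‖ ≤ k * φ z) :
    tentENorm p q α β f ≠ ∞ := by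
  have hq0 : 0 < q := by linarith
  have h1 : f = fun z => f z / φ z * φ z :=
    funext fun z => (div_mul_cancel₀ _ (hφ.pos z).ne').symm
  rw [h1]
  refine ne_top_of_le_ne_top ?_ (hφ.tentENorm_mul_le hp0 hp hq _)
  exact ENNReal.mul_ne_top (ENNReal.rpow_ne_top_of_nonneg (by positivity) (measure_ne_top _ _))
    (ENNReal.rpow_ne_top_of_nonneg (by positivity)
      (hφ.lintegral_rpow_ne_top hq0.le (hφ.norm_div_le hf)))

/-- The set where a function is at most a multiple of the weight. -/
def weightLevel (φ f : E n × ℝ → ℝ) (k : ℕ) : Set (E n × ℝ) := {z | ‖f z‖ ≤ k * φ z}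

lemma IsTentWeight.measurableSet_weightLevel (hφ : IsTentWeight α β φ ψ) {f : E n × ℝ → ℝ}
    (hf : Measurable f) (k : ℕ) : MeasurableSet (weightLevel φ f k) :=
  measurableSet_le hf.norm (hφ.measurable.const_mul _)

lemma IsTentWeight.monotone_weightLevel (hφ : IsTentWeight α β φ ψ) (f : E n × ℝ → ℝ) :
    Monotone (weightLevel φ f) := fun k l hkl z hz => by
  refine le_trans (show ‖f z‖ ≤ k * φ z from hz) ?_
  have := (hφ.pos z).le
  gcongr

lemma IsTentWeight.exists_mem_weightLevel (hφ : IsTentWeight α β φ ψ) (f : E n × ℝ → ℝ)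
    (z : E n × ℝ) : ∃ k, z ∈ weightLevel φ f k := by
  obtain ⟨k, hk⟩ := exists_nat_ge (‖f z‖ / φ z)
  exact ⟨k, (div_le_iff₀ (hφ.pos z)).1 hk⟩

lemma IsTentWeight.norm_indicator_weightLevel_le (hφ : IsTentWeight α β φ ψ) (f : E n × ℝ → ℝ)
    (k : ℕ) (z : E n × ℝ) : ‖(weightLevel φ f k).indicator f z‖ ≤ k * φ z := by
  by_cases hz : z ∈ weightLevel φ f k
  · rw [indicator_of_mem hz]; exact hz
  · rw [indicator_of_notMem hz, norm_zero]
    have := (hφ.pos z).le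
    positivity

end truncation

section representation

open Filter Topology

variable {n : ℕ} {p : ℝ≥0∞} {q α β : ℝ} [hp1 : Fact (1 ≤ p)] [hq1 : Fact (1 ≤ q)]

/-! ### Functionals on the tent spaces are given by kernels -/

/-- The element of the tent space given by a function. -/
def toTent (f : E n × ℝ → ℝ) (hf : Measurable f) (h : tentENorm p q α β f < ∞) :
    tentSpace n p q α β :=
  ⟨AEEqFun.mk f hf.aestronglyMeasurable, by
    change tentENorm p q α β _ < ∞
    rwa [tentENorm_congr p q α β (AEEqFun.coeFn_mk f _)]⟩

lemma toTent_coe (f : tentSpace n p q α β) :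
    toTent (f.1 : E n × ℝ → ℝ) f.1.measurable f.2 = f :=
  Subtype.ext (AEEqFun.mk_coeFn f.1)

lemma coeFn_tent_add (f g : tentSpace n p q α β) :
    ∀ᵐ z ∂(halfMeasure n), (f + g).1 z = f.1 z + g.1 z := AEEqFun.coeFn_add f.1 g.1

lemma coeFn_tent_smul (c : ℝ) (f : tentSpace n p q α β) :
    ∀ᵐ z ∂(halfMeasure n), (c • f).1 z = c * f.1 z := AEEqFun.coeFn_smul c f.1

variable [hα : Fact (0 < α)] [hβ : Fact (0 < β)]

lemma enorm_tent_eq (f : tentSpace n p q α β) : ‖f‖ₑ = tentENorm p q α β f.1 := by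
  rw [← ofReal_norm]
  exact ENNReal.ofReal_toReal f.2.ne

lemma enorm_toTent (f : E n × ℝ → ℝ) (hf : Measurable f) (h : tentENorm p q α β f < ∞) :
    ‖toTent f hf h‖ₑ = tentENorm p q α β f := by
  rw [enorm_tent_eq]
  exact tentENorm_congr p q α β (AEEqFun.coeFn_mk f _)

open Classical in
/-- A functional on the tent space, evaluated at functions. -/
def functionalOn (ℓ : StrongDual ℝ (tentSpace n p q α β)) (f : E n × ℝ → ℝ) : ℝ :=
  if h : Measurable f ∧ tentENorm p q α β f < ∞ then ℓ (toTent f h.1 h.2) else 0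

lemma functionalOn_of_lt_top (ℓ : StrongDual ℝ (tentSpace n p q α β)) {f : E n × ℝ → ℝ}
    (hf : Measurable f) (h : tentENorm p q α β f < ∞) :
    functionalOn ℓ f = ℓ (toTent f hf h) := dif_pos ⟨hf, h⟩

lemma functionalOn_coe (ℓ : StrongDual ℝ (tentSpace n p q α β)) (f : tentSpace n p q α β) :
    functionalOn ℓ (f.1 : E n × ℝ → ℝ) = ℓ f := by
  rw [functionalOn_of_lt_top ℓ f.1.measurable f.2, toTent_coe]

lemma functionalOn_add (ℓ : StrongDual ℝ (tentSpace n p q α β)) {f g : E n × ℝ → ℝ}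
    (hf : Measurable f) (hg : Measurable g) (hf' : tentENorm p q α β f < ∞)
    (hg' : tentENorm p q α β g < ∞) :
    functionalOn ℓ (fun z => f z + g z) = functionalOn ℓ f + functionalOn ℓ g := by
  have h : tentENorm p q α β (fun z => f z + g z) < ∞ :=
    (tentENorm_add_le hp1.out hq1.out α β hf hg).trans_lt (ENNReal.add_lt_top.2 ⟨hf', hg'⟩)
  rw [functionalOn_of_lt_top ℓ hf hf', functionalOn_of_lt_top ℓ hg hg',
    functionalOn_of_lt_top ℓ (f := fun z => f z + g z) (hf.add hg) h, ← map_add]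
  rfl

lemma functionalOn_const_mul (ℓ : StrongDual ℝ (tentSpace n p q α β)) (c : ℝ) {f : E n × ℝ → ℝ}
    (hf : Measurable f) (hf' : tentENorm p q α β f < ∞) :
    functionalOn ℓ (fun z => c * f z) = c * functionalOn ℓ f := by
  have h : tentENorm p q α β (fun z => c * f z) < ∞ := by
    rw [tentENorm_smul p hq1.out α β c hf]
    exact ENNReal.mul_lt_top enorm_lt_top hf'
  rw [functionalOn_of_lt_top ℓ hf hf',
    functionalOn_of_lt_top ℓ (f := fun z => c * f z) (hf.const_mul c) h, ← smul_eq_mul, ← map_smul]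
  rfl

/-- The default value 0 outside the tent space makes the bound hold for every function. -/
lemma enorm_functionalOn_le (ℓ : StrongDual ℝ (tentSpace n p q α β)) (f : E n × ℝ → ℝ) :
    ‖functionalOn ℓ f‖ₑ ≤ ‖ℓ‖ₑ * tentENorm p q α β f := by
  unfold functionalOn
  split_ifs with h
  · rw [← enorm_toTent f h.1 h.2]
    exact ℓ.le_opENorm _
  · simp

variable {φ : E n × ℝ → ℝ} {ψ : E n × ℝ → NNReal}

/-- A functional on a tent space is integration against a kernel, on the functions that are
dominated by a weight. -/
lemma IsTentWeight.exists_kernel (hφ : IsTentWeight α β φ ψ) (hp : p ≠ ∞)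
    (ℓ : StrongDual ℝ (tentSpace n p q α β)) :
    ∃ g : E n × ℝ → ℝ, Measurable g ∧ ∀ f : E n × ℝ → ℝ, Measurable f →
      (∃ k : ℝ, ∀ z, ‖f z‖ ≤ k * φ z) →
        Integrable (fun z => g z * f z) (halfMeasure n) ∧
          functionalOn ℓ f = ∫ z, g z * f z ∂(halfMeasure n) := by
  have hp0 : p ≠ 0 := (zero_lt_one.trans_le hp1.out).ne'
  have hq0 : 0 < q := zero_lt_one.trans_le hq1.out
  set ρ := (halfMeasure n).withDensity fun z => (ψ z : ℝ≥0∞)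
  have : IsFiniteMeasure ρ := isFiniteMeasure_withDensity hφ.lintegral_density_ne_top
  have hfin : ∀ {b : E n × ℝ → ℝ}, (∃ k, ∀ z, ‖b z‖ ≤ k) →
      tentENorm p q α β (fun z => b z * φ z) < ∞ := fun {b} ⟨k, hk⟩ => by
    refine (hφ.tentENorm_ne_top hp0 hp hq1.out (k := k) fun z => ?_).lt_top
    rw [norm_mul, Real.norm_of_nonneg (hφ.pos z).le]
    exact mul_le_mul_of_nonneg_right (hk z) (hφ.pos z).le
  obtain ⟨g, hg, hgi, hgb⟩ := exists_density_of_le_lintegral_rpow (ρ := ρ)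
    (fun b => functionalOn ℓ fun z => b z * φ z) hq0
    (C := ‖ℓ‖ₑ * gauss n univ ^ (1 / p.toReal))
    (ENNReal.mul_ne_top enorm_ne_top
      (ENNReal.rpow_ne_top_of_nonneg (by positivity) (measure_ne_top _ _)))
    (fun b b' hb hb' hk hk' => by
      simp only [add_mul]
      exact functionalOn_add ℓ (hb.mul hφ.measurable) (hb'.mul hφ.measurable) (hfin hk) (hfin hk'))
    (fun c b hb hk => by
      simp only [mul_assoc]
      exact functionalOn_const_mul ℓ c (hb.mul hφ.measurable) (hfin hk))
    (fun b hb hk => by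
      refine (enorm_functionalOn_le ℓ _).trans ?_
      rw [mul_assoc]
      gcongr
      exact hφ.tentENorm_mul_le hp0 hp hq1.out b)
  -- Writing `f = (f / φ) * φ` with `f / φ` bounded, the functional is the integral of `(f / φ) * g`
  -- against the density `ψ`.
  refine ⟨fun z => ψ z * g z / φ z, (hφ.measurable_density.coe_nnreal_real.mul hg).div
    hφ.measurable, fun f hf ⟨k, hk⟩ => ?_⟩
  have hb : Measurable fun z => f z / φ z := hf.div hφ.measurable
  have hbk := hφ.norm_div_le hk
  have e1 : (fun z => f z / φ z * φ z) = f := funext fun z => div_mul_cancel₀ _ (hφ.pos z).ne'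
  have e2 : (fun z => ψ z * g z / φ z * f z) = fun z => ψ z • (f z / φ z * g z) := funext fun z => by
    rw [NNReal.smul_def, smul_eq_mul]
    ring
  have h1 := hgb _ hb ⟨k, hbk⟩
  rw [e1] at h1
  rw [e2, ← integrable_withDensity_iff_integrable_smul hφ.measurable_density,
    ← integral_withDensity_eq_integral_smul hφ.measurable_density]
  exact ⟨hgi.bdd_mul hb.aestronglyMeasurable (Eventually.of_forall hbk), h1⟩

/-- Multiplication of the absolute value of a function by the sign of another one. -/
def signedAbs {X : Type*} (g f : X → ℝ) (z : X) : ℝ := if 0 ≤ g z then |f z| else -|f z|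

lemma measurable_signedAbs {X : Type*} [MeasurableSpace X] {g f : X → ℝ} (hg : Measurable g)
    (hf : Measurable f) : Measurable (signedAbs g f) :=
  Measurable.ite (measurableSet_le measurable_const hg) hf.abs hf.abs.neg

lemma norm_signedAbs {X : Type*} (g f : X → ℝ) (z : X) : ‖signedAbs g f z‖ = ‖f z‖ := by
  unfold signedAbs
  split_ifs <;> simp

lemma enorm_signedAbs {X : Type*} (g f : X → ℝ) (z : X) : ‖signedAbs g f z‖ₑ = ‖f z‖ₑ := by
  rw [← ofReal_norm, norm_signedAbs, ofReal_norm]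

lemma mul_signedAbs {X : Type*} (g f : X → ℝ) (z : X) :
    g z * signedAbs g f z = ‖f z‖ * ‖g z‖ := by
  unfold signedAbs
  split_ifs with h
  · rw [Real.norm_eq_abs, Real.norm_eq_abs, abs_of_nonneg h, mul_comm]
  · rw [Real.norm_eq_abs, Real.norm_eq_abs, abs_of_neg (not_le.1 h)]
    ring

/-- A bound for signed pairings gives a bound for absolute pairings. -/
lemma IsTentWeight.lintegral_enorm_mul_le_of_kernel (hφ : IsTentWeight α β φ ψ)
    {g : E n × ℝ → ℝ} (hg : Measurable g) (ℓ : StrongDual ℝ (tentSpace n p q α β))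
    (hgℓ : ∀ f : E n × ℝ → ℝ, Measurable f → (∃ k : ℝ, ∀ z, ‖f z‖ ≤ k * φ z) →
      Integrable (fun z => g z * f z) (halfMeasure n) ∧
        functionalOn ℓ f = ∫ z, g z * f z ∂(halfMeasure n))
    {f : E n × ℝ → ℝ} (hf : Measurable f) :
    ∫⁻ z, ‖f z‖ₑ * ‖g z‖ₑ ∂(halfMeasure n) ≤ ‖ℓ‖ₑ * tentENorm p q α β f := by
  refine le_of_tendsto (tendsto_lintegral_indicator (halfMeasure n) (hf.enorm.mul hg.enorm)
    (hφ.measurableSet_weightLevel hf) (hφ.monotone_weightLevel f) (hφ.exists_mem_weightLevel f))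
    (Eventually.of_forall fun k => ?_)
  -- The truncation is dominated by the weight, so the kernel formula applies to it with the sign of
  -- `g` attached; the integrand is then nonnegative and equal to the absolute pairing.
  set u := (weightLevel φ f k).indicator f
  have hu : Measurable u := hf.indicator (hφ.measurableSet_weightLevel hf k)
  obtain ⟨h1, h2⟩ := hgℓ (signedAbs g u) (measurable_signedAbs hg hu) ⟨k, fun z => by
    rw [norm_signedAbs]; exact hφ.norm_indicator_weightLevel_le f k z⟩
  simp only [mul_signedAbs] at h1 h2
  calc _ = ∫⁻ z, ENNReal.ofReal (‖u z‖ * ‖g z‖) ∂(halfMeasure n) := by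
        refine lintegral_congr fun z => ?_
        rw [ENNReal.ofReal_mul (norm_nonneg _), ofReal_norm, ofReal_norm]
        by_cases hz : z ∈ weightLevel φ f k <;> simp [u, hz]
    _ = ENNReal.ofReal (functionalOn ℓ (signedAbs g u)) := by
        rw [h2, ofReal_integral_eq_lintegral_ofReal h1
          (Eventually.of_forall fun z => mul_nonneg (norm_nonneg _) (norm_nonneg _))]
    _ ≤ ‖functionalOn ℓ (signedAbs g u)‖ₑ := Real.ofReal_le_enorm _
    _ ≤ ‖ℓ‖ₑ * tentENorm p q α β (signedAbs g u) := enorm_functionalOn_le ℓ _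
    _ ≤ _ := by
        gcongr
        refine tentENorm_mono p (zero_lt_one.trans_le hq1.out) fun z => ?_
        rw [enorm_signedAbs]
        exact enorm_indicator_le_enorm_self _ _

/-- The set of functions dominated by a weight is norming for the pairing of two tent spaces. -/
def IsNormingPairing (φ : E n × ℝ → ℝ) (p p' : ℝ≥0∞) (q q' α β : ℝ) : Prop :=
  ∃ C : ℝ≥0∞, C ≠ ∞ ∧ ∀ (g : E n × ℝ → ℝ) (k : ℝ) (L : ℝ≥0∞), Measurable g →
    (∀ z, ‖g z‖ ≤ k * φ z) →
    (∀ f : E n × ℝ → ℝ, Measurable f →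
      ∫⁻ z, ‖f z‖ₑ * ‖g z‖ₑ ∂(halfMeasure n) ≤ L * tentENorm p q α β f) →
    tentENorm p' q' α β g ≤ C * L

/-- Every functional on a tent space is represented by an element of the dual tent space, if the
pairing is norming. -/
lemma IsTentWeight.exists_representative (hφ : IsTentWeight α β φ ψ) (hp : p ≠ ∞) {p' : ℝ≥0∞}
    (hp' : p' ≠ 0) {q' : ℝ} (hq' : 0 < q') (hN : IsNormingPairing φ p p' q q' α β) :
    ∃ C : ℝ≥0∞, C ≠ ∞ ∧ ∀ ℓ : StrongDual ℝ (tentSpace n p q α β),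
      ∃ g : E n × ℝ → ℝ, Measurable g ∧ tentENorm p' q' α β g ≤ C * ‖ℓ‖ₑ ∧
        ∀ f : tentSpace n p q α β, ℓ f = ∫ z, g z * f.1 z ∂(halfMeasure n) := by
  have hp0 : p ≠ 0 := (zero_lt_one.trans_le hp1.out).ne'
  have hq0 : 0 < q := zero_lt_one.trans_le hq1.out
  obtain ⟨C, hC, hnorm⟩ := hN
  refine ⟨C, hC, fun ℓ => ?_⟩
  obtain ⟨g, hg, hgℓ⟩ := hφ.exists_kernel hp ℓ
  have hpair := fun {f : E n × ℝ → ℝ} (hf : Measurable f) =>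
    hφ.lintegral_enorm_mul_le_of_kernel hg ℓ hgℓ hf
  refine ⟨g, hg, ?_, fun f => ?_⟩
  -- The norming property is available only for functions dominated by the weight. It is applied to
  -- the truncations of `g`, with a constant independent of the level, and the Fatou property
  -- concludes.
  · refine tentENorm_le_of_forall_indicator_le hα.out hβ.out hp' hq' hg
      (hφ.measurableSet_weightLevel hg) (hφ.monotone_weightLevel g) (hφ.exists_mem_weightLevel g)
      fun k => ?_
    refine hnorm _ k _ (hg.indicator (hφ.measurableSet_weightLevel hg k))
      (hφ.norm_indicator_weightLevel_le g k) fun f hf => le_trans ?_ (hpair hf)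
    gcongr with z
    exact enorm_indicator_le_enorm_self _ _
  · set F : E n × ℝ → ℝ := ⇑f.1
    have hF : Measurable F := f.1.measurable
    have hFt : tentENorm p q α β F < ∞ := f.2
    set A := weightLevel φ F
    have hA : ∀ k, MeasurableSet (A k) := hφ.measurableSet_weightLevel hF
    have hev : ∀ z, ∀ᶠ k in atTop, z ∈ A k := fun z => by
      obtain ⟨k, hk⟩ := hφ.exists_mem_weightLevel F z
      filter_upwards [eventually_ge_atTop k] with l hl
      exact hφ.monotone_weightLevel F hl hk
    have hk := fun k => hgℓ ((A k).indicator F) (hF.indicator (hA k))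
      ⟨k, hφ.norm_indicator_weightLevel_le F k⟩
    have hint : Integrable (fun z => g z * F z) (halfMeasure n) := by
      refine ⟨(hg.mul hF).aestronglyMeasurable, ?_⟩
      refine lt_of_le_of_lt (lintegral_mono fun z => ?_)
        ((hpair hF).trans_lt (ENNReal.mul_lt_top enorm_lt_top hFt))
      rw [enorm_mul, mul_comm]
    have hlim1 : Tendsto (fun k => functionalOn ℓ ((A k).indicator F)) atTop
        (𝓝 (∫ z, g z * F z ∂(halfMeasure n))) := by
      simp only [fun k => (hk k).2]
      refine tendsto_integral_of_dominated_convergence (fun z => ‖g z * F z‖)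
        (fun k => (hk k).1.aestronglyMeasurable) hint.norm
        (fun k => Eventually.of_forall fun z => ?_) (Eventually.of_forall fun z => ?_)
      · rw [norm_mul, norm_mul]
        gcongr
        exact norm_indicator_le_norm_self _ _
      · refine tendsto_const_nhds.congr' ?_
        filter_upwards [hev z] with k hz
        rw [indicator_of_mem hz]
    -- The remainders off `A k` tend to 0 in the tent norm, which is where finite `p` is used.
    have hlim2 : Tendsto (fun k => functionalOn ℓ ((A k).indicator F)) atTop (𝓝 (ℓ f)) := by
      have hdiff : ∀ k, ℓ f = functionalOn ℓ ((A k).indicator F) +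
          functionalOn ℓ ((A k)ᶜ.indicator F) := fun k => by
        have hle : ∀ B : Set (E n × ℝ), tentENorm p q α β (B.indicator F) < ∞ := fun B =>
          (tentENorm_mono p hq0 fun z => enorm_indicator_le_enorm_self _ _).trans_lt hFt
        rw [← functionalOn_add ℓ (hF.indicator (hA k)) (hF.indicator (hA k).compl) (hle _) (hle _),
          ← functionalOn_coe]
        congr 1
        funext z
        exact (congrFun (indicator_self_add_compl (A k) F) z).symm
      have h0 := tendsto_tentENorm_indicator hp0 hp hq0 hF hFt.ne (A := fun k => (A k)ᶜ)
        (fun k => (hA k).compl) fun z => (hev z).mono fun k hz hz' => hz' hz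
      have h1 := ENNReal.Tendsto.const_mul h0 (.inr (enorm_ne_top (x := ℓ)))
      rw [mul_zero] at h1
      rw [tendsto_iff_edist_tendsto_0]
      refine tendsto_of_tendsto_of_tendsto_of_le_of_le tendsto_const_nhds h1
        (fun _ => zero_le) fun k => ?_
      rw [edist_comm, edist_eq_enorm_sub, hdiff k, add_sub_cancel_left]
      exact enorm_functionalOn_le ℓ _
    exact tendsto_nhds_unique hlim2 hlim1

end representation

section norming

variable {n : ℕ} {α β : ℝ} {φ : E n × ℝ → ℝ} {ψ : E n × ℝ → NNReal}

/-! ### The pairing of the tent spaces is norming -/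

/-- The absorption that ends each test-function argument. It needs `I` finite, hence the restriction
of `IsNormingPairing` to functions dominated by a weight. -/
lemma rpow_le_of_le_mul_rpow {q q' : ℝ} (hq : q.HolderConjugate q') {I a : ℝ≥0∞} (hI : I ≠ ∞)
    (h : I ≤ a * I ^ (1 / q)) : I ^ (1 / q') ≤ a := by
  rcases eq_or_ne I 0 with rfl | h0
  · rw [ENNReal.zero_rpow_of_pos hq.symm.one_div_pos]
    exact zero_le
  · have h1 : I = I ^ (1 / q') * I ^ (1 / q) := by
      rw [← ENNReal.rpow_add _ _ h0 hI, one_div, one_div, hq.symm.inv_add_inv_eq_one,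
        ENNReal.rpow_one]
    nth_rewrite 1 [h1] at h
    refine (ENNReal.mul_le_mul_iff_left ?_ ?_).1 h
    · simp [h0, hI]
    · exact ENNReal.rpow_ne_top_of_nonneg hq.one_div_nonneg hI

/-- The identity `(q' - 1) * q = q'`, which makes `|g|^(q'-1)` extremal in Hölder's inequality. -/
lemma rpow_sub_one_rpow {q q' : ℝ} (hq : q.HolderConjugate q') (a : ℝ≥0∞) :
    (a ^ (q' - 1)) ^ q = a ^ q' := by
  rw [← ENNReal.rpow_mul, sub_mul, mul_comm q' q, hq.mul_eq_add]
  congr 1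
  ring

lemma rpow_sub_one_mul {r : ℝ} (hr : 1 ≤ r) (a : ℝ≥0∞) : a ^ (r - 1) * a = a ^ r := by
  conv_lhs => rw [← ENNReal.rpow_one a, ← ENNReal.rpow_mul,
    ← ENNReal.rpow_add_of_nonneg _ _ (by linarith) zero_le_one]
  congr 1
  ring

lemma IsTentWeight.lintegral_enorm_rpow_ne_top (hφ : IsTentWeight α β φ ψ) {q : ℝ} (hq : 1 ≤ q)
    {g : E n × ℝ → ℝ} {k : ℝ} (hg : ∀ z, ‖g z‖ ≤ k * φ z) :
    ∫⁻ z, ‖g z‖ₑ ^ q ∂(halfMeasure n) ≠ ∞ := by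
  have hq0 : 0 ≤ q := by linarith
  refine ne_top_of_le_ne_top (ENNReal.mul_ne_top (ENNReal.rpow_ne_top_of_nonneg hq0
    (ENNReal.ofReal_ne_top (r := k))) hφ.lintegral_ne_top) ?_
  rw [← lintegral_const_mul _ hφ.measurable.enorm]
  refine lintegral_mono fun z => ?_
  have h1 : ‖φ z‖ₑ ≤ 1 := by
    rw [Real.enorm_eq_ofReal (hφ.pos z).le]
    exact ENNReal.ofReal_le_one.2 (hφ.le_one z)
  calc ‖g z‖ₑ ^ q ≤ (ENNReal.ofReal k * ‖φ z‖ₑ) ^ q := by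
        gcongr
        rw [Real.enorm_eq_ofReal (hφ.pos z).le, ← ENNReal.ofReal_mul' (hφ.pos z).le, ← ofReal_norm]
        exact ENNReal.ofReal_le_ofReal (hg z)
    _ = ENNReal.ofReal k ^ q * ‖φ z‖ₑ ^ q := ENNReal.mul_rpow_of_nonneg _ _ hq0
    _ ≤ _ := by
        gcongr
        simpa using ENNReal.rpow_le_rpow_of_exponent_ge h1 hq

/-- A function supported in a tent over a set has an area function supported in the set. -/
lemma areaFun_indicator_tent_eq_zero {q : ℝ} (hq : 0 < q) (f : E n × ℝ → ℝ) {O : Set (E n)}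
    {x : E n} (hx : x ∉ O) : areaFun q α β ((tent α β O).indicator f) x = 0 := by
  rw [areaFun_eq, coneIntegral, setLIntegral_congr_fun (g := fun _ => 0) (measurableSet_cone α β x)]
  · simp [hq]
  · intro z hz
    have hzT : z ∉ tent α β O := fun h => hx (mem_of_mem_tent h hz)
    simp [hzT, hq]

/-- The endpoint case: Carleson's condition is tested on functions supported in tents. -/
lemma IsTentWeight.isNormingPairing_one (hφ : IsTentWeight α β φ ψ) (hα : 0 < α) (hβ : 0 < β)
    {q q' : ℝ} (hq : q.HolderConjugate q') : IsNormingPairing φ 1 ∞ q q' α β := by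
  refine ⟨1, ENNReal.one_ne_top, fun g k L hg hgk hL => ?_⟩
  rw [one_mul]
  refine tentENorm_top_le hq.symm.pos fun c r _ => ?_
  set B := Metric.ball c r
  set T := tent α β B
  have hT : MeasurableSet T := measurableSet_tent B
  set J := ∫⁻ z in T, ‖g z‖ₑ ^ q' ∂(halfMeasure n) with hJ
  have hJt : J ≠ ∞ := ne_top_of_le_ne_top (hφ.lintegral_enorm_rpow_ne_top hq.symm.lt.le hgk)
    (setLIntegral_le_lintegral _ _)
  -- The extremal function on the tent: its pairing with `g` and the `q`-th power integral of its
  -- area function are both `J`.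
  set f : E n × ℝ → ℝ := T.indicator fun z => ‖g z‖ ^ (q' - 1) with hf
  have hfm : Measurable f := (hg.norm.pow_const _).indicator hT
  have hfe : ∀ z, ‖f z‖ₑ = T.indicator (fun z => ‖g z‖ₑ ^ (q' - 1)) z := fun z => by
    by_cases hz : z ∈ T
    · rw [hf, indicator_of_mem hz, indicator_of_mem hz,
        Real.enorm_rpow_of_nonneg (norm_nonneg _) hq.symm.sub_one_pos.le, enorm_norm]
    · rw [hf, indicator_of_notMem hz, indicator_of_notMem hz, enorm_zero]
  have hpair : ∫⁻ z, ‖f z‖ₑ * ‖g z‖ₑ ∂(halfMeasure n) = J := by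
    rw [hJ, ← lintegral_indicator hT]
    refine lintegral_congr fun z => ?_
    rw [hfe]
    by_cases hz : z ∈ T
    · rw [indicator_of_mem hz, indicator_of_mem hz, rpow_sub_one_mul hq.symm.lt.le]
    · rw [indicator_of_notMem hz, indicator_of_notMem hz, zero_mul]
  have hfq : ∫⁻ x, areaFun q α β f x ^ q ∂(gauss n) = J := by
    simp only [areaFun_rpow hq.pos]
    rw [lintegral_coneIntegral hα hβ (hfm.enorm.pow_const q), hJ, ← lintegral_indicator hT]
    refine lintegral_congr fun z => ?_
    rw [hfe]
    by_cases hz : z ∈ T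
    · rw [indicator_of_mem hz, indicator_of_mem hz, rpow_sub_one_rpow hq]
    · rw [indicator_of_notMem hz, indicator_of_notMem hz, ENNReal.zero_rpow_of_pos hq.pos]
  -- The area function of `f` vanishes off `B`, so Hölder on `B` passes from exponent 1 to `q`.
  have hnorm : tentENorm 1 q α β f ≤ J ^ (1 / q) * gauss n B ^ (1 / q') := by
    rw [tentENorm_of_ne_top one_ne_zero ENNReal.one_ne_top]
    simp only [ENNReal.toReal_one, ENNReal.rpow_one, one_div_one]
    have h1 := ENNReal.lintegral_mul_le_Lp_mul_Lq (gauss n) hq (f := areaFun q α β f)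
      (g := B.indicator fun _ => 1) (measurable_areaFun q α β hfm).aemeasurable
      (measurable_const.indicator measurableSet_ball).aemeasurable
    rw [hfq] at h1
    convert h1 using 3 with x
    · by_cases hx : x ∈ B
      · simp only [Pi.mul_apply, indicator_of_mem hx, mul_one]
      · rw [Pi.mul_apply, hf, areaFun_indicator_tent_eq_zero hq.pos _ hx, zero_mul]
    · rw [← lintegral_indicator_one measurableSet_ball]
      refine lintegral_congr fun x => ?_
      by_cases hx : x ∈ B
      · rw [indicator_of_mem hx, indicator_of_mem hx, ENNReal.one_rpow, Pi.one_apply]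
      · rw [indicator_of_notMem hx, indicator_of_notMem hx, ENNReal.zero_rpow_of_pos hq.symm.pos]
  have h2 : J ≤ L * gauss n B ^ (1 / q') * J ^ (1 / q) := by
    calc J ≤ L * tentENorm 1 q α β f := hpair ▸ hL f hfm
      _ ≤ L * (J ^ (1 / q) * gauss n B ^ (1 / q')) := by gcongr
      _ = _ := by ring
  have h3 := rpow_le_of_le_mul_rpow hq hJt h2
  rw [one_div, ENNReal.rpow_inv_le_iff hq.symm.pos,
    ENNReal.mul_rpow_of_nonneg _ _ hq.symm.pos.le, ← ENNReal.rpow_mul,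
    inv_mul_cancel₀ hq.symm.ne_zero, ENNReal.rpow_one] at h3
  exact h3

/-- The maximal function estimate behind the norming property. -/
lemma exists_lintegral_admMaximal_mul_le (n : ℕ) (hα : 0 < α) (hβ : 0 < β) {r r' q q' : ℝ}
    (hr : r.HolderConjugate r') (hq : q.HolderConjugate q') (hrq : r ≤ q) :
    ∃ C : ℝ≥0∞, C ≠ ∞ ∧ ∀ V : E n → ℝ≥0∞, Measurable V → (∃ b : ℝ≥0∞, b ≠ ∞ ∧ ∀ x, V x ≤ b) →
      ∫⁻ x, admMaximal α β (fun x => V x ^ (r' / q' - 1)) x ^ r * V x ^ (r / q) ∂(gauss n) ≤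
        C * ∫⁻ x, V x ^ (r' / q') ∂(gauss n) := by
  have hr0 := hr.pos
  have hq0 := hq.pos
  -- If `r = q`, the exponent `r' / q' - 1` is 0 and the maximal function is that of the constant 1;
  -- no strong type inequality is needed.
  rcases hrq.eq_or_lt with rfl | hlt
  · obtain rfl : r' = q' := hr.conjugate_eq.trans hq.conjugate_eq.symm
    refine ⟨1, ENNReal.one_ne_top, fun V _ _ => ?_⟩
    rw [one_mul, div_self hr.symm.ne_zero, div_self hr.ne_zero]
    refine lintegral_mono fun x => mul_le_of_le_one_left zero_le ?_
    refine ENNReal.rpow_le_one (admMaximal_le_of_le (fun y => ?_) x) hr0.le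
    simp
  set θ := r' / q' with hθ
  have hθ1 : 1 < θ := by
    rw [hθ, one_lt_div hq.symm.pos, hr.conjugate_eq, hq.conjugate_eq,
      div_lt_div_iff₀ hq.sub_one_pos hr.sub_one_pos]
    nlinarith
  -- Chosen so that `(r / q) * u' = θ`. The conjugate exponent then gives `r * u = s = θ / (θ - 1)`,
  -- and the maximal inequality in `L^s` for `V ^ (θ - 1)` returns the integral of `V ^ θ` once
  -- more.
  set u' := θ * q / r with hu'
  have hqr : 1 < q / r := (one_lt_div hr0).2 hlt
  have hu1 : 1 < u' := by
    rw [hu', mul_div_assoc]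
    nlinarith
  set u := u'.conjExponent
  have hu : u.HolderConjugate u' := (Real.HolderConjugate.conjExponent hu1).symm
  set s := θ / (θ - 1) with hs
  have hs1 : 1 < s := by
    rw [hs, one_lt_div (by linarith)]
    linarith
  have hrel : θ * (q * (r - 1)) = r * (q - 1) := by
    have h1 := hr.sub_one_pos.ne'
    have h2 := hq.sub_one_pos.ne'
    rw [hθ, hr.conjugate_eq, hq.conjugate_eq]
    field_simp
  have hsr : r * u = s := by
    have h1 : u' - 1 ≠ 0 := by linarith
    have h2 : θ - 1 ≠ 0 := by linarith
    change r * (u' / (u' - 1)) = s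
    rw [hs, mul_div_assoc', div_eq_div_iff h1 h2]
    have e1 : r * u' = θ * q := by rw [hu', mul_div_cancel₀ _ hr0.ne']
    refine mul_left_cancel₀ hr0.ne' ?_
    linear_combination (r * (θ - 1) - θ) * e1 + θ * hrel
  obtain ⟨C, hC, hmax⟩ := exists_admMaximal_strong_type n hα hβ hs1
  refine ⟨C ^ (1 / u), ENNReal.rpow_ne_top_of_nonneg hu.one_div_nonneg hC,
    fun V hV ⟨b, hb, hVb⟩ => ?_⟩
  set h : E n → ℝ≥0∞ := fun x => V x ^ (θ - 1)
  have hθ0 : 0 ≤ θ - 1 := by linarith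
  have hhm : Measurable h := hV.pow_const _
  have hmax' := hmax h hhm ⟨b ^ (θ - 1), ENNReal.rpow_ne_top_of_nonneg hθ0 hb,
    fun x => ENNReal.rpow_le_rpow (hVb x) hθ0⟩
  have hhs : ∫⁻ x, h x ^ s ∂(gauss n) = ∫⁻ x, V x ^ θ ∂(gauss n) := by
    refine lintegral_congr fun x => ?_
    rw [← ENNReal.rpow_mul, hs, mul_div_cancel₀ _ (by linarith : θ - 1 ≠ 0)]
  rw [hhs] at hmax'
  set I := ∫⁻ x, V x ^ θ ∂(gauss n)
  have hH := ENNReal.lintegral_mul_le_Lp_mul_Lq (gauss n) hu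
    (f := fun x => admMaximal α β h x ^ r) (g := fun x => V x ^ (r / q))
    ((measurable_admMaximal h).pow_const _).aemeasurable (hV.pow_const _).aemeasurable
  refine hH.trans ?_
  simp only [← ENNReal.rpow_mul]
  have e : r / q * u' = θ := by rw [hu']; field_simp
  rw [hsr, e]
  calc _ ≤ (C * I) ^ (1 / u) * I ^ (1 / u') :=
        mul_le_mul_left (ENNReal.rpow_le_rpow hmax' hu.one_div_nonneg) _
    _ = C ^ (1 / u) * I := by
        rw [ENNReal.mul_rpow_of_nonneg _ _ hu.one_div_nonneg, mul_assoc,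
          ← ENNReal.rpow_add_of_nonneg _ _ hu.one_div_nonneg hu.symm.one_div_nonneg, one_div u,
          one_div u', hu.inv_add_inv_eq_one, ENNReal.rpow_one]

/-- The case of small exponents: the norming functions are explicit. -/
lemma IsTentWeight.isNormingPairing_of_le (hφ : IsTentWeight α β φ ψ) (hα : 0 < α) (hβ : 0 < β)
    {p p' : ℝ≥0∞} (hp : p ≠ ∞) (hp' : p' ≠ ∞) (hpp' : p.HolderConjugate p')
    {q q' : ℝ} (hq : q.HolderConjugate q') (hpq : p.toReal ≤ q) :
    IsNormingPairing φ p p' q q' α β := by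
  have hp0 : p ≠ 0 := ENNReal.HolderConjugate.ne_zero p p'
  have hp0' : p' ≠ 0 := ENNReal.HolderConjugate.ne_zero p' p
  have hr : p.toReal.HolderConjugate p'.toReal := ENNReal.HolderConjugate.toReal_of_ne_top hp hp'
  set r := p.toReal
  set r' := p'.toReal
  have hr0 := hr.pos
  have hq0 := hq.pos
  have hq0' := hq.symm.pos
  set θ := r' / q' with hθ
  have hθ1 : 1 ≤ θ := by
    rw [hθ, one_le_div hq0', hr.conjugate_eq, hq.conjugate_eq,
      div_le_div_iff₀ hq.sub_one_pos hr.sub_one_pos]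
    nlinarith
  have hθ0 : 0 ≤ θ - 1 := by linarith
  obtain ⟨C, hC, hmax⟩ := exists_lintegral_admMaximal_mul_le n hα hβ hr hq hpq
  refine ⟨C ^ (1 / r), ENNReal.rpow_ne_top_of_nonneg hr.one_div_nonneg hC,
    fun g k L hg hgk hL => ?_⟩
  have hF : Measurable fun z => ‖g z‖ₑ ^ q' := hg.enorm.pow_const q'
  set V : E n → ℝ≥0∞ := coneIntegral α β fun z => ‖g z‖ₑ ^ q'
  have hV : Measurable V := measurable_coneIntegral hF
  -- Domination of `g` by the weight bounds `V`, hence makes `I` finite for the final absorption.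
  obtain ⟨b, hb, hVb⟩ : ∃ b : ℝ≥0∞, b ≠ ∞ ∧ ∀ x, V x ≤ b := by
    refine ⟨_, hφ.lintegral_rpow_ne_top hq0'.le (hφ.norm_div_le hgk), fun x => ?_⟩
    convert hφ.coneIntegral_mul_le hq.symm.lt.le (fun z => g z / φ z) x using 1
    have e : (fun z => g z / φ z * φ z) = g := funext fun z => div_mul_cancel₀ _ (hφ.pos z).ne'
    simp only [fun z => congrFun e z]
    rfl
  set h : E n → ℝ≥0∞ := fun x => V x ^ (θ - 1)
  have hh : Measurable h := hV.pow_const _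
  set I := ∫⁻ x, V x ^ θ ∂(gauss n) with hI
  have hIt : I ≠ ∞ := by
    refine ne_top_of_le_ne_top (ENNReal.mul_ne_top (ENNReal.rpow_ne_top_of_nonneg
      (by linarith : 0 ≤ θ) hb) (measure_ne_top (gauss n) univ)) ?_
    rw [← lintegral_const]
    exact lintegral_mono fun x => ENNReal.rpow_le_rpow (hVb x) (by linarith)
  -- The average is dual to the cone integral, so the pairing with `g` becomes the integral of `V *
  -- V ^ (θ - 1) = V ^ θ`, which is the integral of the area function of `g` to the power `r'`.
  set F : E n × ℝ → ℝ≥0∞ := fun z => ‖g z‖ₑ ^ (q' - 1) * ballAverage α β h z with hFdef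
  have hFm : Measurable F := (hg.enorm.pow_const _).mul (measurable_ballAverage hh)
  have hFt : ∀ z, F z ≠ ∞ := fun z => by
    refine ENNReal.mul_ne_top (ENNReal.rpow_ne_top_of_nonneg hq.symm.sub_one_pos.le enorm_ne_top) ?_
    exact ne_top_of_le_ne_top (ENNReal.rpow_ne_top_of_nonneg hθ0 hb)
      (ballAverage_le_of_le (fun x => ENNReal.rpow_le_rpow (hVb x) hθ0) z)
  set f : E n × ℝ → ℝ := fun z => (F z).toReal
  have hfm : Measurable f := hFm.ennreal_toReal
  have hfe : ∀ z, ‖f z‖ₑ = F z := fun z => by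
    rw [Real.enorm_eq_ofReal ENNReal.toReal_nonneg, ENNReal.ofReal_toReal (hFt z)]
  have hpair : ∫⁻ z, ‖f z‖ₑ * ‖g z‖ₑ ∂(halfMeasure n) = I := by
    calc _ = ∫⁻ z, ‖g z‖ₑ ^ q' * ballAverage α β h z ∂(halfMeasure n) := by
          refine lintegral_congr fun z => ?_
          rw [hfe, hFdef, mul_right_comm, rpow_sub_one_mul hq.symm.lt.le]
      _ = ∫⁻ x, V x * h x ∂(gauss n) := (lintegral_coneIntegral_mul hF hh).symm
      _ = I := lintegral_congr fun x => by rw [mul_comm, rpow_sub_one_mul hθ1]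
  -- On the cone at `x` every average of `h` is at most the maximal function at `x`, which comes out
  -- of the cone integral.
  have hS : ∀ x, areaFun q α β f x ^ r ≤ admMaximal α β h x ^ r * V x ^ (r / q) := fun x => by
    have h1 : coneIntegral α β (fun z => ‖f z‖ₑ ^ q) x ≤ admMaximal α β h x ^ q * V x := by
      simp only [V, coneIntegral]
      rw [← lintegral_const_mul _ (by exact hF.div measurable_ballMass)]
      refine setLIntegral_mono' (measurableSet_cone α β x) fun z hz => ?_
      rw [hfe, hFdef, ENNReal.mul_rpow_of_nonneg _ _ hq0.le, rpow_sub_one_rpow hq, mul_comm,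
        mul_div_assoc]
      gcongr
      exact ballAverage_le_admMaximal h hz
    calc areaFun q α β f x ^ r ≤ ((admMaximal α β h x ^ q * V x) ^ (1 / q)) ^ r := by
          rw [areaFun_eq]
          gcongr
      _ = _ := by
          rw [← ENNReal.rpow_mul, ENNReal.mul_rpow_of_nonneg _ _ (by positivity),
            ← ENNReal.rpow_mul]
          congr 2 <;> field_simp
  have hnorm : tentENorm p q α β f ≤ (C * I) ^ (1 / r) := by
    rw [tentENorm_of_ne_top hp0 hp]
    gcongr
    exact (lintegral_mono hS).trans (hmax V hV ⟨b, hb, hVb⟩)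
  have h2 : I ≤ C ^ (1 / r) * L * I ^ (1 / r) := by
    calc I ≤ L * tentENorm p q α β f := hpair ▸ hL f hfm
      _ ≤ L * (C * I) ^ (1 / r) := by gcongr
      _ = _ := by rw [ENNReal.mul_rpow_of_nonneg _ _ hr.one_div_nonneg]; ring
  have h3 : tentENorm p' q' α β g = I ^ (1 / r') := by
    rw [tentENorm_of_ne_top hp0' hp', hI]
    congr 1
    refine lintegral_congr fun x => ?_
    rw [areaFun_eq, ← ENNReal.rpow_mul, one_div_mul_eq_div]
  rw [h3]
  exact rpow_le_of_le_mul_rpow hr hIt h2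

/-- The case of large exponents follows from the case of small ones by the Hahn–Banach theorem. -/
lemma IsTentWeight.isNormingPairing_of_ge (hφ : IsTentWeight α β φ ψ) [hα : Fact (0 < α)]
    [hβ : Fact (0 < β)] {p p' : ℝ≥0∞} [Fact (1 ≤ p')] (hp : p ≠ ∞)
    (hp' : p' ≠ ∞) (hpp' : p.HolderConjugate p') {q q' : ℝ} [hq1 : Fact (1 ≤ q')]
    (hq : q.HolderConjugate q') (hpq : q ≤ p.toReal) : IsNormingPairing φ p p' q q' α β := by
  have hp0 : p ≠ 0 := ENNReal.HolderConjugate.ne_zero p p'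
  have hp0' : p' ≠ 0 := ENNReal.HolderConjugate.ne_zero p' p
  have hr : p.toReal.HolderConjugate p'.toReal := ENNReal.HolderConjugate.toReal_of_ne_top hp hp'
  have hpq' : p'.toReal ≤ q' := by
    rw [hr.conjugate_eq, hq.conjugate_eq, div_le_div_iff₀ hr.sub_one_pos hq.sub_one_pos]
    nlinarith
  -- The roles are exchanged: as `p' ≤ q'`, functionals on the space with exponents `p'`, `q'` are
  -- represented with norm control.
  obtain ⟨C, hC, hrep⟩ := hφ.exists_representative hp' hp0 hq.pos
    (hφ.isNormingPairing_of_le hα.out hβ.out hp' hp hpp'.symm hq.symm hpq')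
  refine ⟨C, hC, fun g k L hg hgk hL => ?_⟩
  have hgt := (hφ.tentENorm_ne_top hp0' hp' hq1.out hgk).lt_top
  set G := toTent g hg hgt
  rw [← enorm_toTent g hg hgt]
  by_cases h0 : ‖G‖ = 0
  · rw [← ofReal_norm, h0]
    simp
  -- A functional of norm 1 that attains the norm of `G`; its representative `f` is a test function
  -- for `hL` with norm at most `C`.
  obtain ⟨ℓ, hℓ1, hℓ⟩ := exists_dual_vector ℝ G h0
  obtain ⟨f, hf, hfC, hfℓ⟩ := hrep ℓ
  have hℓe : ‖ℓ‖ₑ = 1 := by rw [← ofReal_norm, hℓ1, ENNReal.ofReal_one]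
  rw [hℓe, mul_one] at hfC
  have hGg : ∀ᵐ z ∂(halfMeasure n), G.1 z = g z := AEEqFun.coeFn_mk g hg.aestronglyMeasurable
  calc ‖G‖ₑ = ‖ℓ G‖ₑ := by rw [hℓ]; simp
    _ = ‖∫ z, f z * g z ∂(halfMeasure n)‖ₑ := by
        rw [hfℓ]
        congr 1
        refine integral_congr_ae ?_
        filter_upwards [hGg] with z hz
        rw [hz]
    _ ≤ ∫⁻ z, ‖f z‖ₑ * ‖g z‖ₑ ∂(halfMeasure n) := by
        simpa only [enorm_mul] using enorm_integral_le_lintegral_enorm (μ := halfMeasure n)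
          fun z => f z * g z
    _ ≤ L * tentENorm p q α β f := hL f hf
    _ ≤ L * C := by gcongr
    _ = C * L := mul_comm _ _

lemma IsTentWeight.isNormingPairing (hφ : IsTentWeight α β φ ψ) [hα : Fact (0 < α)]
    [hβ : Fact (0 < β)] {p p' : ℝ≥0∞} [Fact (1 ≤ p')] (hp : p ≠ ∞)
    (hpp' : p.HolderConjugate p') {q q' : ℝ} [Fact (1 ≤ q')]
    (hq : q.HolderConjugate q') : IsNormingPairing φ p p' q q' α β := by
  by_cases hp' : p' = ∞
  · have hsymm : p'.HolderConjugate p := hpp'.symm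
    obtain rfl : p = 1 := (ENNReal.HolderConjugate.eq_top_iff_eq_one p' p).1 hp'
    subst hp'
    exact hφ.isNormingPairing_one hα.out hβ.out hq
  · rcases le_total p.toReal q with h | h
    · exact hφ.isNormingPairing_of_le hα.out hβ.out hp hp' hpp' hq h
    · exact hφ.isNormingPairing_of_ge hp hp' hpp' hq h

end norming

section duality

variable {n : ℕ} {p p' : ℝ≥0∞} {q q' α β : ℝ} [hp1 : Fact (1 ≤ p)] [hp1' : Fact (1 ≤ p')]
  [hq1 : Fact (1 ≤ q)] [hq1' : Fact (1 ≤ q')] [hα : Fact (0 < α)] [hβ : Fact (0 < β)]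

/-! ### The duality theorem -/

lemma exists_tent_lintegral_enorm_mul_le (hp : p ≠ ∞) (hpp' : p.HolderConjugate p')
    (hq : q.HolderConjugate q') :
    ∃ C : ℝ≥0∞, C ≠ ∞ ∧ ∀ (g : tentSpace n p' q' α β) (f : tentSpace n p q α β),
      ∫⁻ z, ‖g.1 z * f.1 z‖ₑ ∂(halfMeasure n) ≤ C * (‖g‖ₑ * ‖f‖ₑ) := by
  obtain ⟨C, hC, h⟩ := exists_lintegral_enorm_mul_le n hα.out hβ.out hp hpp' hq
  refine ⟨C, hC, fun g f => ?_⟩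
  have := h f.1.measurable g.1.measurable g.2.ne
  rw [← enorm_tent_eq, ← enorm_tent_eq, mul_comm ‖f‖ₑ] at this
  refine le_of_eq_of_le (lintegral_congr fun z => ?_) this
  rw [enorm_mul, mul_comm]

lemma integrable_tent_mul (hp : p ≠ ∞) (hpp' : p.HolderConjugate p') (hq : q.HolderConjugate q')
    (g : tentSpace n p' q' α β) (f : tentSpace n p q α β) :
    Integrable (fun z => g.1 z * f.1 z) (halfMeasure n) := by
  obtain ⟨C, hC, h⟩ := exists_tent_lintegral_enorm_mul_le (n := n) (α := α) (β := β) hp hpp' hq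
  refine ⟨(g.1.measurable.mul f.1.measurable).aestronglyMeasurable, (h g f).trans_lt ?_⟩
  exact ENNReal.mul_lt_top hC.lt_top (ENNReal.mul_lt_top enorm_lt_top enorm_lt_top)

/-- Every functional on a tent space is the pairing with an element of the dual tent space. -/
lemma exists_tent_representative (hp : p ≠ ∞) (hpp' : p.HolderConjugate p')
    (hq : q.HolderConjugate q') :
    ∃ C : ℝ, ∀ ℓ : StrongDual ℝ (tentSpace n p q α β), ∃ g : tentSpace n p' q' α β,
      ‖g‖ ≤ C * ‖ℓ‖ ∧ ∀ f, ℓ f = ∫ z, g.1 z * f.1 z ∂(halfMeasure n) := by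
  obtain ⟨φ, ψ, hφ⟩ := exists_isTentWeight n hα.out hβ.out
  obtain ⟨C, hC, hrep⟩ := hφ.exists_representative (q := q) hp
    (zero_lt_one.trans_le hp1'.out).ne' hq.symm.pos (hφ.isNormingPairing hp hpp' hq)
  refine ⟨C.toReal, fun ℓ => ?_⟩
  obtain ⟨g, hg, hgC, hgℓ⟩ := hrep ℓ
  have hfin : C * ‖ℓ‖ₑ < ∞ := ENNReal.mul_lt_top hC.lt_top enorm_lt_top
  refine ⟨toTent g hg (hgC.trans_lt hfin), ?_, fun f => ?_⟩
  · rw [← toReal_enorm, ← toReal_enorm, ← ENNReal.toReal_mul, enorm_toTent]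
    exact ENNReal.toReal_mono hfin.ne hgC
  · rw [hgℓ]
    refine integral_congr_ae ?_
    filter_upwards [AEEqFun.coeFn_mk g hg.aestronglyMeasurable] with z hz
    exact congrArg (· * f.1 z) hz.symm

/-- An element of the dual tent space is determined by the pairing. -/
lemma tent_eq_zero_of_integral_eq_zero (hp : p ≠ ∞) (hpp' : p.HolderConjugate p')
    (hq : q.HolderConjugate q') (g : tentSpace n p' q' α β)
    (h : ∀ f : tentSpace n p q α β, ∫ z, g.1 z * f.1 z ∂(halfMeasure n) = 0) : g = 0 := by
  obtain ⟨φ, ψ, hφ⟩ := exists_isTentWeight n hα.out hβ.out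
  -- Testing on the weight with the sign of `g` gives the integral of `φ * |g|`, and `φ` is positive
  -- everywhere.
  have hm : Measurable (signedAbs (⇑g.1) φ) := measurable_signedAbs g.1.measurable hφ.measurable
  have hfin : tentENorm p q α β (signedAbs (⇑g.1) φ) < ∞ := by
    refine (hφ.tentENorm_ne_top (zero_lt_one.trans_le hp1.out).ne' hp hq1.out (k := 1)
      fun z => ?_).lt_top
    rw [norm_signedAbs, Real.norm_of_nonneg (hφ.pos z).le, one_mul]
  set f := toTent _ hm hfin
  have hae : (fun z => g.1 z * f.1 z) =ᵐ[halfMeasure n] fun z => ‖φ z‖ * ‖g.1 z‖ := by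
    filter_upwards [AEEqFun.coeFn_mk _ hm.aestronglyMeasurable] with z hz
    rw [← mul_signedAbs]
    exact congrArg (g.1 z * ·) hz
  have h0 := h f
  rw [integral_congr_ae hae, integral_eq_zero_iff_of_nonneg
    (fun z => mul_nonneg (norm_nonneg _) (norm_nonneg _))
    ((integrable_congr hae).1 (integrable_tent_mul hp hpp' hq g f))] at h0
  refine Subtype.ext (AEEqFun.ext (Filter.EventuallyEq.trans ?_ AEEqFun.coeFn_zero.symm))
  filter_upwards [h0] with z hz
  simpa [(hφ.pos z).ne'] using hz

end duality

end GaussTent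

end

open GaussTent in
theorem theorem3p4 (n : ℕ) (hn : 1 ≤ n) (α β : ℝ) [Fact (0 < α)] [Fact (0 < β)]
    (p p' : ℝ≥0∞) [Fact (1 ≤ p)] [Fact (1 ≤ p')] (hp : p ≠ ∞) (hpp' : p.HolderConjugate p')
    (q q' : ℝ) [Fact (1 ≤ q)] [Fact (1 ≤ q')] (hqq' : q.HolderConjugate q') :
    ∃ Φ : tentSpace n p' q' α β ≃L[ℝ] StrongDual ℝ (tentSpace n p q α β),
      ∀ (g : tentSpace n p' q' α β) (f : tentSpace n p q α β),
        Integrable (fun z : E n × ℝ => g.1 z * f.1 z) (halfMeasure n) ∧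
          Φ g f = ∫ z : E n × ℝ, g.1 z * f.1 z ∂(halfMeasure n) := by
  obtain ⟨C₁, hC₁, hpair⟩ :=
    exists_tent_lintegral_enorm_mul_le (n := n) (α := α) (β := β) hp hpp' hqq'
  obtain ⟨C₂, hrep⟩ := exists_tent_representative (n := n) (α := α) (β := β) hp hpp' hqq'
  have hint : ∀ (g : tentSpace n p' q' α β) (f : tentSpace n p q α β),
      Integrable (fun z => g.1 z * f.1 z) (halfMeasure n) := integrable_tent_mul hp hpp' hqq'
  have hbound : ∀ (g : tentSpace n p' q' α β) (f : tentSpace n p q α β),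
      ‖∫ z, g.1 z * f.1 z ∂(halfMeasure n)‖ ≤ C₁.toReal * ‖g‖ * ‖f‖ := fun g f => by
    have h1 := (enorm_integral_le_lintegral_enorm fun z => g.1 z * f.1 z).trans (hpair g f)
    have h2 := ENNReal.toReal_mono (ENNReal.mul_ne_top hC₁
      (ENNReal.mul_ne_top enorm_ne_top enorm_ne_top)) h1
    rwa [ENNReal.toReal_mul, ENNReal.toReal_mul, toReal_enorm, toReal_enorm, toReal_enorm,
      ← mul_assoc] at h2
  let B : tentSpace n p' q' α β →ₗ[ℝ] tentSpace n p q α β →ₗ[ℝ] ℝ :=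
    LinearMap.mk₂ ℝ (fun g f => ∫ z, g.1 z * f.1 z ∂(halfMeasure n))
      (fun g g' f => by
        rw [← integral_add (hint g f) (hint g' f)]
        refine integral_congr_ae ?_
        filter_upwards [coeFn_tent_add g g'] with z hz
        rw [hz, add_mul])
      (fun c g f => by
        rw [smul_eq_mul, ← integral_const_mul]
        refine integral_congr_ae ?_
        filter_upwards [coeFn_tent_smul c g] with z hz
        rw [hz, mul_assoc])
      (fun g f f' => by
        rw [← integral_add (hint g f) (hint g f')]
        refine integral_congr_ae ?_
        filter_upwards [coeFn_tent_add f f'] with z hz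
        rw [hz, mul_add])
      (fun c g f => by
        rw [smul_eq_mul, ← integral_const_mul]
        refine integral_congr_ae ?_
        filter_upwards [coeFn_tent_smul c f] with z hz
        rw [hz, mul_left_comm])
  let T : tentSpace n p' q' α β →L[ℝ] StrongDual ℝ (tentSpace n p q α β) :=
    LinearMap.mkContinuous₂ B C₁.toReal hbound
  have hT : ∀ g f, T g f = ∫ z, g.1 z * f.1 z ∂(halfMeasure n) := fun _ _ => rfl
  have hinj : Function.Injective T := (injective_iff_map_eq_zero T).2 fun g hg =>
    tent_eq_zero_of_integral_eq_zero hp hpp' hqq' g fun f => by rw [← hT, hg]; rfl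
  have hsurj : ∀ ℓ, ∃ g, ‖g‖ ≤ C₂ * ‖ℓ‖ ∧ T g = ℓ := fun ℓ => by
    obtain ⟨g, hg, hgℓ⟩ := hrep ℓ
    exact ⟨g, hg, ContinuousLinearMap.ext fun f => ((hT g f).trans (hgℓ f).symm)⟩
  let e : tentSpace n p' q' α β ≃ₗ[ℝ] StrongDual ℝ (tentSpace n p q α β) :=
    LinearEquiv.ofBijective T.toLinearMap ⟨hinj, fun ℓ => (hsurj ℓ).imp fun _ h => h.2⟩
  -- The norm bound on representatives is the continuity of the inverse, so completeness and the
  -- open mapping theorem are not needed.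
  refine ⟨e.toContinuousLinearEquivOfBounds ‖T‖ C₂ T.le_opNorm fun ℓ => ?_,
    fun g f => ⟨hint g f, rfl⟩⟩
  obtain ⟨g, hg, rfl⟩ := hsurj ℓ
  have : e.symm (T g) = g := e.symm_apply_apply g
  rwa [this]
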